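/- **Setting.** Let $\mathscr C$ be either the category $\mathrm{Ab}^{\mathrm A}$ of Banach abelian groups (abelian groups with a complete norm) and bounded homomorphisms, or its full subcategory $\mathrm{Ab}^{\mathrm{nA}}$ of ultrametric ones. For a commutative Banach ring $A$ in $\mathscr C$, let $\mathrm{Mod}_{\mathscr C}(A)$ be the category of Banach $A$-modules in $\mathscr C$ (complete normed $A$-modules $M$, ultrametric if $\mathscr C=\mathrm{Ab}^{\mathrm{nA}}$, with $\|am\|\le C\|a\|\,\|m\|$ for some constant $C$) and bounded $A$-linear maps. The completed tensor product $M\widehat\otimes_A N$ is the completion of $M\otimes_A N$ for the seminorm $t\mapsto\inf\sum_i\|m_i\|\,\|n_i\|$ (resp. $\inf\max_i\|m_i\|\,\|n_i\|$ if $\mathscr C=\mathrm{Ab}^{\mathrm{nA}}$), the infimum being over all expressions $t=\sum_i m_i\otimes n_i$. A sequence $M\xrightarrow{f}N\xrightarrow{g}P$ is strictly exact at $N$ if $\overline{f(M)}=\ker g$ and $f$ is strict, i.e. $M/\ker f\to\overline{f(M)}$ is an isomorphism; a morphism of complexes is a quasi-isomorphism if its mapping cone is strictly exact in every degree; and $\mathrm{Der}^-_{\mathscr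 C}(A)$ is the localization of the homotopy category of bounded above complexes in $\mathrm{Mod}_{\mathscr C}(A)$ at the quasi-isomorphisms. The derived tensor product is $M\widehat\otimes^{\mathbb L}_A N=\mathrm{Tot}(P(M)\widehat\otimes_A P(N))$, where $P(M)$ is the functorial projective resolution $\cdots\to\ell(Z_2,A)\to\ell(Z_1,A)\to\ell(Z_0,A)$ with $Z_0=M$ and $Z_{n+1}=\ker(\ell(Z_n,A)\to Z_n)$; here $\ell(Z,A)$ is the completed direct sum over $z\in Z$ of copies of $A$ with norm rescaled by $\|z\|$ (the $\ell^1$-sum, resp. the $c_0$-sum if $\mathscr C=\mathrm{Ab}^{\mathrm{nA}}$), and $\ell(Z,A)\to Z$ sends the generator at $z$ to $z$. A bounded homomorphism $A_0\to A_1$ of Banach $R$-algebras in $\mathscr C$ is a *homotopy epimorphism* if the multiplication $A_1\widehat\otimes^{\mathbb L}_{A_0}A_1\to A_1$ is an isomorphism in $\mathrm{Der}^-_{\mathscr C}(A_0)$. **Theorem.** Let $X$ be a compact Hausdorff space and let $R$ be a Banach ring such that $(\mathscr C,X,R)$ is an admissible triple, i.e. one of the following holds: 1. $\mathscr C=\mathrm{Ab}^{\mathrm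 A}$, and $R$ is $\mathbb R$ or $\mathbb C$ with the usual absolute value; 2. $\mathscr C=\mathrm{Ab}^{\mathrm{nA}}$, $R$ is a finite field with the trivial norm or a non-Archimedean local field, and $X$ is totally disconnected. Then for every closed subset $K\subset X$ the restriction map $C(X,R)\to C(K,R)$, where both algebras carry the supremum norm, is a homotopy epimorphism of Banach $R$-algebras in $\mathscr C$. -/

import Mathlib

open CategoryTheory Limits TensorProduct
open scoped NNReal

universe u v

namespace BanachGeometry

/-! ## The two categories of Banach abelian groups -/

/-- The two ambient categories: `arch` is the category of Banach abelian groups and bounded group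
homomorphisms, `nonarch` its full subcategory of ultrametric Banach abelian groups. -/
inductive Ambient : Type
  | arch
  | nonarch

/-- The ultrametric inequality, imposed only in the case of the ambient category `nonarch`. -/
class Ultra (𝒞 : Ambient) (E : Type*) [Dist E] : Prop where
  isUltrametricDist : 𝒞 = .nonarch → IsUltrametricDist E

/-- The scalar multiplication `A × E → E` is bounded: `‖a • x‖ ≤ C ‖a‖ ‖x‖` for a constant `C`. -/
class BddSMul (A E : Type*) [Norm A] [Norm E] [SMul A E] : Prop where
  exists_bound : ∃ C : ℝ≥0, ∀ (a : A) (x : E), ‖a • x‖ ≤ C * ‖a‖ * ‖x‖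

/-- A map between normed sets is bounded if `‖f x‖ ≤ C ‖x‖` for a constant `C`. -/
def IsBdd {E F : Type*} [Norm E] [Norm F] (f : E → F) : Prop :=
  ∃ C : ℝ≥0, ∀ x, ‖f x‖ ≤ C * ‖x‖

/-- The size of a finite family of nonnegative reals: its sum in the Archimedean case, its maximum
(`0` for the empty family) in the non-Archimedean case. -/
noncomputable def agg (𝒞 : Ambient) {ι : Type*} (s : Finset ι) (w : ι → ℝ≥0) : ℝ≥0 :=
  match 𝒞 with
  | .arch => ∑ i ∈ s, w i
  | .nonarch => s.sup w

/-- The size of a pair of nonnegative reals (sum, resp. maximum). -/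
noncomputable def comb (𝒞 : Ambient) (a b : ℝ≥0) : ℝ≥0 :=
  match 𝒞 with
  | .arch => a + b
  | .nonarch => max a b

section Aux

variable {𝒞 : Ambient} {ι : Type*}

theorem comb_le_add (a b : ℝ≥0) : comb 𝒞 a b ≤ a + b := by
  cases 𝒞 <;> simp [comb]

theorem comb_mono {a b c d : ℝ≥0} (h : a ≤ c) (h' : b ≤ d) : comb 𝒞 a b ≤ comb 𝒞 c d := by
  cases 𝒞
  · exact add_le_add h h'
  · exact max_le_max h h'

theorem comb_add_le (a b e : ℝ≥0) : comb 𝒞 (a + e) (b + e) ≤ comb 𝒞 a b + (e + e) := by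
  cases 𝒞
  · simp only [comb]
    exact le_of_eq (by ring)
  · simp only [comb]
    refine max_le ?_ ?_
    · exact add_le_add (le_max_left _ _) (le_add_of_nonneg_left (zero_le (a := e)))
    · exact add_le_add (le_max_right _ _) (le_add_of_nonneg_left (zero_le (a := e)))

theorem agg_le_mul (s : Finset ι) (w v : ι → ℝ≥0) (c : ℝ≥0) (h : ∀ i ∈ s, w i ≤ c * v i) :
    agg 𝒞 s w ≤ c * agg 𝒞 s v := by
  cases 𝒞
  · simp only [agg, Finset.mul_sum]
    exact Finset.sum_le_sum h
  · simp only [agg]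
    exact Finset.sup_le fun i hi => (h i hi).trans (mul_le_mul_right (Finset.le_sup hi) c)

theorem agg_comb_le (s : Finset ι) (w v z : ι → ℝ≥0) (h : ∀ i ∈ s, w i ≤ comb 𝒞 (v i) (z i)) :
    agg 𝒞 s w ≤ comb 𝒞 (agg 𝒞 s v) (agg 𝒞 s z) := by
  cases 𝒞
  · simp only [agg, comb, ← Finset.sum_add_distrib] at h ⊢
    exact Finset.sum_le_sum h
  · simp only [agg, comb] at h ⊢
    exact Finset.sup_le fun i hi =>
      (h i hi).trans (max_le_max (Finset.le_sup hi) (Finset.le_sup hi))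

theorem agg_subset {s t : Finset ι} (hst : s ⊆ t) (w : ι → ℝ≥0) (h : ∀ i ∈ t, i ∉ s → w i = 0) :
    agg 𝒞 t w = agg 𝒞 s w := by
  cases 𝒞
  · exact (Finset.sum_subset hst h).symm
  · simp only [agg]
    refine le_antisymm (Finset.sup_le fun i hi => ?_) (Finset.sup_mono hst)
    by_cases his : i ∈ s
    · exact Finset.le_sup his
    · rw [h i hi his]
      exact zero_le

theorem agg_append {m n : ℕ} (w : Fin (m + n) → ℝ≥0) :
    agg 𝒞 Finset.univ w ≤ comb 𝒞 (agg 𝒞 Finset.univ fun i => w (Fin.castAdd n i))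
      (agg 𝒞 Finset.univ fun i => w (Fin.natAdd m i)) := by
  cases 𝒞
  · simp only [agg, comb, Fin.sum_univ_add, le_refl]
  · simp only [agg, comb]
    refine Finset.sup_le fun i _ => ?_
    induction i using Fin.addCases with
    | left i =>
      exact le_max_of_le_left
        (Finset.le_sup (f := fun i => w (Fin.castAdd n i)) (Finset.mem_univ i))
    | right i =>
      exact le_max_of_le_right
        (Finset.le_sup (f := fun i => w (Fin.natAdd m i)) (Finset.mem_univ i))

theorem nnnorm_add_le_comb {E : Type*} [SeminormedAddCommGroup E] [h : Ultra 𝒞 E] (x y : E) :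
    ‖x + y‖₊ ≤ comb 𝒞 ‖x‖₊ ‖y‖₊ := by
  cases 𝒞
  · exact nnnorm_add_le x y
  · have := h.isUltrametricDist rfl
    exact IsUltrametricDist.norm_add_le_max x y

theorem nnnorm_sum_le_agg {E : Type*} [SeminormedAddCommGroup E] [h : Ultra 𝒞 E]
    (s : Finset ι) (x : ι → E) : ‖∑ i ∈ s, x i‖₊ ≤ agg 𝒞 s fun i => ‖x i‖₊ := by
  classical
  cases 𝒞
  · exact nnnorm_sum_le _ _
  · have := h.isUltrametricDist rfl
    simp only [agg]
    induction s using Finset.induction_on with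
    | empty => simp
    | insert a s ha ih =>
      rw [Finset.sum_insert ha, Finset.sup_insert]
      exact (IsUltrametricDist.norm_add_le_max _ _).trans (max_le_max le_rfl ih)

theorem ultra_of_comb {E : Type*} [SeminormedAddCommGroup E]
    (h : ∀ x y : E, ‖x + y‖₊ ≤ comb 𝒞 ‖x‖₊ ‖y‖₊) : Ultra 𝒞 E where
  isUltrametricDist hC := by
    subst hC
    exact IsUltrametricDist.isUltrametricDist_of_forall_norm_add_le_max_norm fun x y => h x y

end Aux

/-! ## Banach modules -/

/-- A Banach `A`-module in the ambient category `𝒞`: an `A`-module with a complete norm, ultrametric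
if `𝒞 = nonarch`, for which the scalar multiplication is bounded (no submultiplicativity is
imposed). -/
structure BanMod (𝒞 : Ambient) (A : Type u) [NormedCommRing A] where
  carrier : Type u
  [normed : NormedAddCommGroup carrier]
  [module : Module A carrier]
  [bddSMul : BddSMul A carrier]
  [complete : CompleteSpace carrier]
  [ultra : Ultra 𝒞 carrier]

namespace BanMod

variable {𝒞 : Ambient} {A : Type u} [NormedCommRing A]

instance : CoeSort (BanMod 𝒞 A) (Type u) := ⟨carrier⟩

attribute [instance] normed module bddSMul complete ultra

end BanMod

/-- The group of bounded `A`-linear maps. -/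
def bddHom (A E F : Type*) [NormedCommRing A] [SeminormedAddCommGroup E] [Module A E]
    [SeminormedAddCommGroup F] [Module A F] : AddSubgroup (E →ₗ[A] F) where
  carrier := {f | IsBdd f}
  zero_mem' := ⟨0, by simp⟩
  add_mem' := by
    rintro f g ⟨C, hC⟩ ⟨D, hD⟩
    refine ⟨C + D, fun x => (norm_add_le _ _).trans ?_⟩
    rw [NNReal.coe_add, add_mul]
    exact add_le_add (hC x) (hD x)
  neg_mem' := by
    rintro f ⟨C, hC⟩
    exact ⟨C, fun x => by simpa using hC x⟩

namespace BanMod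

variable {𝒞 : Ambient} {A : Type u} [NormedCommRing A]

/-- The category of Banach `A`-modules and bounded `A`-linear maps. -/
instance : Category (BanMod 𝒞 A) where
  Hom M N := bddHom A M N
  id M := ⟨LinearMap.id, 1, by simp⟩
  comp f g := ⟨g.1 ∘ₗ f.1, by
    obtain ⟨C, hC⟩ := f.2
    obtain ⟨D, hD⟩ := g.2
    refine ⟨D * C, fun x => (hD _).trans ?_⟩
    rw [NNReal.coe_mul, mul_assoc]
    exact mul_le_mul_of_nonneg_left (hC x) D.2⟩

/-- The linear map underlying a morphism of Banach modules. -/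
def Hom.lin {M N : BanMod 𝒞 A} (f : M ⟶ N) : M →ₗ[A] N := f.1

/-- The morphism of Banach modules given by a bounded linear map. -/
def ofLin {M N : BanMod 𝒞 A} (f : M →ₗ[A] N) (hf : IsBdd f) : M ⟶ N := ⟨f, hf⟩

theorem Hom.isBdd {M N : BanMod 𝒞 A} (f : M ⟶ N) : IsBdd (Hom.lin f) := f.2

@[simp] theorem lin_ofLin {M N : BanMod 𝒞 A} (f : M →ₗ[A] N) (hf : IsBdd f) :
    Hom.lin (ofLin f hf) = f := rfl

theorem hom_ext {M N : BanMod 𝒞 A} {f g : M ⟶ N} (h : ∀ x, Hom.lin f x = Hom.lin g x) : f = g :=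
  Subtype.ext (LinearMap.ext h)

@[simp] theorem lin_id (M : BanMod 𝒞 A) (x : M) : Hom.lin (𝟙 M) x = x := rfl

@[simp] theorem lin_comp {M N P : BanMod 𝒞 A} (f : M ⟶ N) (g : N ⟶ P) (x : M) :
    Hom.lin (f ≫ g) x = Hom.lin g (Hom.lin f x) := rfl

instance : Preadditive (BanMod 𝒞 A) where
  homGroup M N := inferInstanceAs (AddCommGroup (bddHom A M N))
  add_comp _ _ _ f f' g := hom_ext fun x => map_add (Hom.lin g) (Hom.lin f x) (Hom.lin f' x)
  comp_add _ _ _ _ _ _ := hom_ext fun _ => rfl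

@[simp] theorem lin_add {M N : BanMod 𝒞 A} (f g : M ⟶ N) (x : M) :
    Hom.lin (f + g) x = Hom.lin f x + Hom.lin g x := rfl

@[simp] theorem lin_zero {M N : BanMod 𝒞 A} (x : M) : Hom.lin (0 : M ⟶ N) x = 0 := rfl

/-- The zero Banach module. -/
def zero : BanMod 𝒞 A where
  carrier := PUnit
  bddSMul := ⟨0, by simp⟩
  ultra := ⟨fun _ => ⟨fun _ _ _ => by simp⟩⟩

instance : HasZeroObject (BanMod 𝒞 A) where
  zero := ⟨zero, (IsZero.iff_id_eq_zero _).2 (hom_ext fun _ => rfl)⟩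

/-- The direct sum of two Banach modules, with the maximum norm. -/
def prod (M N : BanMod 𝒞 A) : BanMod 𝒞 A where
  carrier := M × N
  bddSMul := by
    obtain ⟨C, hC⟩ := M.bddSMul.exists_bound
    obtain ⟨D, hD⟩ := N.bddSMul.exists_bound
    refine ⟨max C D, fun a x => max_le ((hC a x.1).trans ?_) ((hD a x.2).trans ?_)⟩
    · gcongr
      · exact NNReal.coe_le_coe.2 (le_max_left C D)
      · exact norm_fst_le x
    · gcongr
      · exact NNReal.coe_le_coe.2 (le_max_right C D)
      · exact norm_snd_le x
  ultra := ultra_of_comb fun x y => by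
    have h1 := nnnorm_add_le_comb (𝒞 := 𝒞) x.1 y.1
    have h2 := nnnorm_add_le_comb (𝒞 := 𝒞) x.2 y.2
    exact max_le (h1.trans (comb_mono (le_max_left _ _) (le_max_left _ _)))
      (h2.trans (comb_mono (le_max_right _ _) (le_max_right _ _)))

instance : HasBinaryBiproducts (BanMod 𝒞 A) where
  has_binary_biproduct M N := by
    let b : BinaryBicone M N :=
      { pt := prod M N
        fst := ofLin (LinearMap.fst A M N) ⟨1, fun x => (norm_fst_le (E := M) (F := N) x).trans_eq (one_mul _).symm⟩
        snd := ofLin (LinearMap.snd A M N) ⟨1, fun x => (norm_snd_le (E := M) (F := N) x).trans_eq (one_mul _).symm⟩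
        inl := ofLin (LinearMap.inl A M N)
          ⟨1, fun x => (by simp : ‖((x, 0) : M × N)‖ = (1 : ℝ≥0) * ‖x‖).le⟩
        inr := ofLin (LinearMap.inr A M N)
          ⟨1, fun x => (by simp : ‖((0, x) : M × N)‖ = (1 : ℝ≥0) * ‖x‖).le⟩
        inl_fst := hom_ext fun x => rfl
        inl_snd := hom_ext fun x => rfl
        inr_fst := hom_ext fun x => rfl
        inr_snd := hom_ext fun x => rfl }
    refine hasBinaryBiproduct_of_total b (hom_ext fun x => ?_)
    exact Prod.fst_add_snd (M := M) (N := N) x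

instance : HasFiniteProducts (BanMod 𝒞 A) := hasFiniteProducts_of_has_binary_and_terminal

instance : HasFiniteBiproducts (BanMod 𝒞 A) := HasFiniteBiproducts.of_hasFiniteProducts

/-- The kernel of a morphism of Banach modules, with the restricted norm. -/
def ker {M N : BanMod 𝒞 A} (f : M ⟶ N) : BanMod 𝒞 A where
  carrier := LinearMap.ker (Hom.lin f)
  bddSMul := by
    obtain ⟨C, hC⟩ := M.bddSMul.exists_bound
    exact ⟨C, fun a x => hC a x.1⟩
  complete := by
    obtain ⟨C, hC⟩ := Hom.isBdd f
    have hf : Continuous (Hom.lin f) :=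
      AddMonoidHomClass.continuous_of_bound (Hom.lin f) C hC
    have : IsClosed ((LinearMap.ker (Hom.lin f) : Submodule A M) : Set M) :=
      isClosed_singleton.preimage hf
    exact this.completeSpace_coe
  ultra := ultra_of_comb fun x y => nnnorm_add_le_comb (𝒞 := 𝒞) x.1 y.1

/-- The inclusion of the kernel. -/
def kerι {M N : BanMod 𝒞 A} (f : M ⟶ N) : ker f ⟶ M :=
  ofLin (LinearMap.ker (Hom.lin f)).subtype ⟨1, fun x => (one_mul ‖x.1‖).symm.le⟩

theorem kerι_comp {M N : BanMod 𝒞 A} (f : M ⟶ N) : kerι f ≫ f = 0 := hom_ext fun x => x.2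

/-! ### Strictness -/

/-- A morphism is strict if `coim f = M / ker f → im f` is an isomorphism. The categorical image of
`f` is the closure of the set-theoretic image, so this says that the set-theoretic image is closed
and that its quotient norm is equivalent to the norm induced from the target. -/
def IsStrict {M N : BanMod 𝒞 A} (f : M ⟶ N) : Prop :=
  IsClosed (Set.range (Hom.lin f)) ∧
    ∃ C : ℝ≥0, ∀ x, ∃ x', Hom.lin f x' = Hom.lin f x ∧ ‖x'‖ ≤ C * ‖Hom.lin f x‖

/-- The sequence `M → N → P` is strictly exact at `N` if `f` is strict and `im f = ker g`, where
`im f` is the categorical image, i.e. the closure of the set-theoretic image. -/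
def StrictlyExactAt {M N P : BanMod 𝒞 A} (f : M ⟶ N) (g : N ⟶ P) : Prop :=
  IsStrict f ∧ closure (Set.range (Hom.lin f)) = {y | Hom.lin g y = 0}

end BanMod

/-! ## Completions -/

section Completion

variable {𝒞 : Ambient} {A : Type u} [NormedCommRing A]

instance {E : Type*} [SeminormedAddCommGroup E] [Module A E] [h : BddSMul A E] :
    UniformContinuousConstSMul A E where
  uniformContinuous_const_smul a := by
    obtain ⟨C, hC⟩ := h.exists_bound
    exact uniformContinuous_of_continuousAt_zero (DistribSMul.toAddMonoidHom E a)
      (AddMonoidHomClass.continuous_of_bound (DistribSMul.toAddMonoidHom E a) (C * ‖a‖)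
        (hC a)).continuousAt

theorem completion_norm_smul_le {E : Type*} [SeminormedAddCommGroup E] [Module A E] [BddSMul A E]
    (C : ℝ≥0) (hC : ∀ (a : A) (x : E), ‖a • x‖ ≤ C * ‖a‖ * ‖x‖) (a : A)
    (x : UniformSpace.Completion E) : ‖a • x‖ ≤ C * ‖a‖ * ‖x‖ := by
  induction x using UniformSpace.Completion.induction_on with
  | hp =>
    exact isClosed_le (continuous_norm.comp (continuous_const_smul a))
      (continuous_const.mul continuous_norm)
  | ih x =>
    rw [← UniformSpace.Completion.coe_smul, UniformSpace.Completion.norm_coe,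
      UniformSpace.Completion.norm_coe]
    exact hC a x

theorem completion_ultrametric {E : Type*} [SeminormedAddCommGroup E] [IsUltrametricDist E] :
    IsUltrametricDist (UniformSpace.Completion E) := by
  refine IsUltrametricDist.isUltrametricDist_of_forall_norm_add_le_max_norm fun x y => ?_
  induction x, y using UniformSpace.Completion.induction_on₂ with
  | hp =>
    exact isClosed_le (continuous_norm.comp continuous_add)
      ((continuous_norm.comp continuous_fst).max (continuous_norm.comp continuous_snd))
  | ih x y =>
    rw [← UniformSpace.Completion.coe_add]
    simp only [UniformSpace.Completion.norm_coe]
    exact IsUltrametricDist.norm_add_le_max x y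

/-- The separated completion of a seminormed module with bounded scalar multiplication. -/
noncomputable def completeObj (𝒞 : Ambient) (A E : Type u) [NormedCommRing A]
    [SeminormedAddCommGroup E] [Module A E] [h : BddSMul A E] [h' : Ultra 𝒞 E] : BanMod 𝒞 A where
  carrier := UniformSpace.Completion E
  bddSMul := ⟨h.exists_bound.choose, completion_norm_smul_le _ h.exists_bound.choose_spec⟩
  ultra := ⟨fun hC => by
    have := h'.isUltrametricDist hC
    exact completion_ultrametric⟩

variable {E : Type u} [SeminormedAddCommGroup E] [Module A E] [BddSMul A E] [Ultra 𝒞 E]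

/-- The canonical map to the completion. -/
def toComplete (x : E) : completeObj 𝒞 A E := (x : UniformSpace.Completion E)

theorem extension_smul {E F : Type*} [SeminormedAddCommGroup E] [Module A E] [BddSMul A E]
    [NormedAddCommGroup F] [Module A F] [BddSMul A F] [CompleteSpace F] (g : NormedAddGroupHom E F)
    (hg : ∀ (a : A) (x : E), g (a • x) = a • g x) (a : A) (x : UniformSpace.Completion E) :
    g.extension (a • x) = a • g.extension x := by
  induction x using UniformSpace.Completion.induction_on with
  | hp =>
    exact isClosed_eq (g.extension.continuous.comp (continuous_const_smul a))
      (g.extension.continuous.const_smul a)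
  | ih x =>
    rw [← UniformSpace.Completion.coe_smul, NormedAddGroupHom.extension_coe,
      NormedAddGroupHom.extension_coe]
    exact hg a x

/-- The extension by continuity of a bounded linear map to the completion. -/
noncomputable def completeLift {N : BanMod 𝒞 A} (f : E →ₗ[A] N) (hf : IsBdd f) :
    completeObj 𝒞 A E ⟶ N :=
  let g : NormedAddGroupHom E N :=
    { toFun := f
      map_add' := map_add f
      bound' := ⟨hf.choose, hf.choose_spec⟩ }
  BanMod.ofLin (M := completeObj 𝒞 A E)
    { toFun := g.extension
      map_add' := map_add g.extension
      map_smul' := extension_smul g (map_smul f) }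
    ⟨‖g.extension‖₊, g.extension.le_opNorm⟩

theorem completeLift_coe {N : BanMod 𝒞 A} (f : E →ₗ[A] N) (hf : IsBdd f) (x : E) :
    BanMod.Hom.lin (completeLift f hf) (toComplete x) = f x :=
  NormedAddGroupHom.extension_coe _ x

theorem continuous_lin {M N : BanMod 𝒞 A} (f : M ⟶ N) : Continuous (BanMod.Hom.lin f) := by
  obtain ⟨C, hC⟩ := BanMod.Hom.isBdd f
  exact AddMonoidHomClass.continuous_of_bound (BanMod.Hom.lin f) C hC

theorem complete_hom_ext {N : BanMod 𝒞 A} {f g : completeObj 𝒞 A E ⟶ N}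
    (h : ∀ x : E, BanMod.Hom.lin f (toComplete x) = BanMod.Hom.lin g (toComplete x)) : f = g :=
  BanMod.hom_ext fun x =>
    UniformSpace.Completion.induction_on (α := E)
      (p := fun x => BanMod.Hom.lin f x = BanMod.Hom.lin g x) x
      (isClosed_eq (continuous_lin f) (continuous_lin g)) h

/-- The canonical map to the completion, as a linear map. -/
def toCompleteLin (𝒞 : Ambient) (A E : Type u) [NormedCommRing A]
    [SeminormedAddCommGroup E] [Module A E] [BddSMul A E] [Ultra 𝒞 E] :
    E →ₗ[A] completeObj 𝒞 A E where
  toFun := toComplete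
  map_add' x y := UniformSpace.Completion.coe_add x y
  map_smul' a x := UniformSpace.Completion.coe_smul a x

theorem norm_toComplete (x : E) : ‖(toComplete x : completeObj 𝒞 A E)‖ = ‖x‖ :=
  UniformSpace.Completion.norm_coe x

end Completion

/-! ## The completed tensor product -/

/-- The algebraic tensor product over `A`, to be equipped with the tensor seminorm. -/
def PreTensor (_𝒞 : Ambient) (A M N : Type u) [NormedCommRing A]
    [NormedAddCommGroup M] [Module A M] [NormedAddCommGroup N] [Module A N] : Type u :=
  M ⊗[A] N

namespace PreTensor

variable {𝒞 : Ambient} {A M N : Type u} [NormedCommRing A]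
  [NormedAddCommGroup M] [Module A M] [NormedAddCommGroup N] [Module A N]

instance : AddCommGroup (PreTensor 𝒞 A M N) := inferInstanceAs (AddCommGroup (M ⊗[A] N))

instance : Module A (PreTensor 𝒞 A M N) := inferInstanceAs (Module A (M ⊗[A] N))

/-- The possible sizes `∑ ‖mᵢ‖ ‖kᵢ‖` (resp. `max ‖mᵢ‖ ‖kᵢ‖`) of expressions `t = ∑ mᵢ ⊗ kᵢ`. -/
def sizes (t : PreTensor 𝒞 A M N) : Set ℝ≥0 :=
  {r | ∃ (n : ℕ) (m : Fin n → M) (k : Fin n → N),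
    ∑ i, (m i ⊗ₜ[A] k i : M ⊗[A] N) = t ∧ agg 𝒞 Finset.univ (fun i => ‖m i‖₊ * ‖k i‖₊) = r}

/-- The tensor seminorm. -/
noncomputable def seminorm (t : PreTensor 𝒞 A M N) : ℝ≥0 := sInf (sizes t)

theorem sizes_nonempty (t : PreTensor 𝒞 A M N) : (sizes t).Nonempty := by
  suffices h : ∃ (n : ℕ) (m : Fin n → M) (k : Fin n → N),
      ∑ i, (m i ⊗ₜ[A] k i : M ⊗[A] N) = t by
    obtain ⟨n, m, k, h⟩ := h
    exact ⟨_, n, m, k, h, rfl⟩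
  induction t using TensorProduct.induction_on with
  | zero => exact ⟨0, 0, 0, rfl⟩
  | tmul x y => exact ⟨1, fun _ => x, fun _ => y, by simp⟩
  | add s t hs ht =>
    obtain ⟨n, m, k, h⟩ := hs
    obtain ⟨n', m', k', h'⟩ := ht
    refine ⟨n + n', Fin.append m m', Fin.append k k', ?_⟩
    rw [Fin.sum_univ_add]
    simp only [Fin.append_left, Fin.append_right]
    rw [h, h']

theorem seminorm_le {t : PreTensor 𝒞 A M N} {r : ℝ≥0} (h : r ∈ sizes t) : seminorm t ≤ r :=
  csInf_le (OrderBot.bddBelow _) h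

theorem exists_size_lt (t : PreTensor 𝒞 A M N) {e : ℝ≥0} (he : 0 < e) :
    ∃ r ∈ sizes t, r < seminorm t + e :=
  exists_lt_of_csInf_lt (sizes_nonempty t) (lt_add_of_pos_right _ he)

theorem seminorm_tmul_le (x : M) (y : N) :
    seminorm (𝒞 := 𝒞) (x ⊗ₜ[A] y : M ⊗[A] N) ≤ ‖x‖₊ * ‖y‖₊ :=
  seminorm_le ⟨1, fun _ => x, fun _ => y, by simp, by cases 𝒞 <;> simp [agg]⟩

theorem seminorm_add_le (s t : PreTensor 𝒞 A M N) :
    seminorm (s + t) ≤ comb 𝒞 (seminorm s) (seminorm t) := by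
  refine le_of_forall_pos_le_add fun e he => ?_
  obtain ⟨r, ⟨n, m, k, h, hr⟩, hlt⟩ := exists_size_lt s (half_pos he)
  obtain ⟨r', ⟨n', m', k', h', hr'⟩, hlt'⟩ := exists_size_lt t (half_pos he)
  have h1 : seminorm (s + t) ≤ agg 𝒞 Finset.univ
      (fun i => ‖Fin.append m m' i‖₊ * ‖Fin.append k k' i‖₊) := by
    refine seminorm_le ⟨n + n', Fin.append m m', Fin.append k k', ?_, rfl⟩
    rw [Fin.sum_univ_add]
    simp only [Fin.append_left, Fin.append_right]
    rw [h, h']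
    rfl
  have h2 := agg_append (𝒞 := 𝒞) (fun i => ‖Fin.append m m' i‖₊ * ‖Fin.append k k' i‖₊)
  simp only [Fin.append_left, Fin.append_right, hr, hr'] at h2
  refine h1.trans (h2.trans ((comb_mono hlt.le hlt'.le).trans ((comb_add_le _ _ _).trans ?_)))
  rw [add_halves]

/-- A bilinear map bounded by `C` induces a linear map of norm at most `C` on the tensor product. -/
theorem nnnorm_lift_le {F : Type*} [SeminormedAddCommGroup F] [Module A F] [Ultra 𝒞 F]
    (B : M →ₗ[A] N →ₗ[A] F) (C : ℝ≥0) (hB : ∀ x y, ‖B x y‖₊ ≤ C * (‖x‖₊ * ‖y‖₊))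
    (t : PreTensor 𝒞 A M N) : ‖TensorProduct.lift B t‖₊ ≤ C * seminorm t := by
  refine le_of_forall_pos_le_add fun e he => ?_
  have hd : 0 < e / (C + 1) := div_pos he (by positivity)
  obtain ⟨r, ⟨n, m, k, h, hr⟩, hlt⟩ := exists_size_lt t hd
  have h1 : TensorProduct.lift B t = ∑ i, B (m i) (k i) := by
    rw [← h, map_sum]
    simp
  rw [h1]
  calc _ ≤ agg 𝒞 Finset.univ fun i => ‖B (m i) (k i)‖₊ := nnnorm_sum_le_agg _ _
    _ ≤ C * r := hr ▸ agg_le_mul _ _ _ _ fun i _ => hB _ _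
    _ ≤ C * (seminorm t + e / (C + 1)) := by gcongr
    _ = C * seminorm t + C * (e / (C + 1)) := mul_add _ _ _
    _ ≤ C * seminorm t + (C + 1) * (e / (C + 1)) := by gcongr; simp
    _ = C * seminorm t + e := by rw [mul_div_cancel₀]; positivity

theorem seminorm_neg_le (t : PreTensor 𝒞 A M N) : seminorm (-t) ≤ seminorm t := by
  refine le_csInf (sizes_nonempty t) ?_
  rintro r ⟨n, m, k, h, rfl⟩
  refine seminorm_le ⟨n, fun i => -m i, k, ?_, by simp⟩
  simp only [TensorProduct.neg_tmul, Finset.sum_neg_distrib]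
  rw [h]
  rfl

noncomputable instance : SeminormedAddCommGroup (PreTensor 𝒞 A M N) :=
  AddGroupSeminorm.toSeminormedAddCommGroup
    { toFun := fun t => seminorm t
      map_zero' := by
        have : seminorm (0 : PreTensor 𝒞 A M N) ≤ 0 :=
          seminorm_le ⟨0, 0, 0, rfl, by cases 𝒞 <;> simp [agg]⟩
        simpa using this
      add_le' := fun s t => by
        exact_mod_cast (seminorm_add_le s t).trans (comb_le_add _ _)
      neg' := fun t => by
        refine congrArg _ (le_antisymm (seminorm_neg_le t) ?_)
        simpa using seminorm_neg_le (-t) }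

theorem nnnorm_def (t : PreTensor 𝒞 A M N) : ‖t‖₊ = seminorm t := rfl

theorem norm_def (t : PreTensor 𝒞 A M N) : ‖t‖ = seminorm t := rfl

instance : Ultra 𝒞 (PreTensor 𝒞 A M N) := ultra_of_comb seminorm_add_le

instance [h : BddSMul A M] : BddSMul A (PreTensor 𝒞 A M N) where
  exists_bound := by
    obtain ⟨C, hC⟩ := h.exists_bound
    refine ⟨C, fun a t => ?_⟩
    suffices H : seminorm (a • t) ≤ C * ‖a‖₊ * seminorm t from H
    let B : M →ₗ[A] N →ₗ[A] PreTensor 𝒞 A M N := a • TensorProduct.mk A M N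
    have hB : TensorProduct.lift B t = a • t := by
      have : TensorProduct.lift B = a • (LinearMap.id : M ⊗[A] N →ₗ[A] M ⊗[A] N) :=
        TensorProduct.ext' fun x y => rfl
      rw [this]
      rfl
    rw [← hB]
    refine nnnorm_lift_le B _ (fun x y => ?_) t
    have h1 : B x y = ((a • x) ⊗ₜ[A] y : M ⊗[A] N) := rfl
    rw [h1, ← mul_assoc]
    have h2 : ‖a • x‖₊ ≤ C * ‖a‖₊ * ‖x‖₊ := hC a x
    exact (seminorm_tmul_le _ _).trans (mul_le_mul_left h2 _)

end PreTensor

namespace BanMod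

variable {𝒞 : Ambient} {A : Type u} [NormedCommRing A]

/-- The completed tensor product `M ⊗̂_A N`: the completion of `M ⊗_A N` for the tensor
seminorm. -/
noncomputable def tensor (M N : BanMod 𝒞 A) : BanMod 𝒞 A := completeObj 𝒞 A (PreTensor 𝒞 A M N)

/-- The morphism `M ⊗̂_A N → P` induced by a bounded bilinear map. -/
noncomputable def tensorLift {M N P : BanMod 𝒞 A} (B : M →ₗ[A] N →ₗ[A] P)
    (hB : ∃ C : ℝ≥0, ∀ x y, ‖B x y‖ ≤ C * (‖x‖ * ‖y‖)) : tensor M N ⟶ P :=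
  completeLift (E := PreTensor 𝒞 A M N) (TensorProduct.lift B) <| by
    obtain ⟨C, hC⟩ := hB
    exact ⟨C, fun t => PreTensor.nnnorm_lift_le B C hC t⟩

/-- The elementary tensor `x ⊗ y` in the completed tensor product. -/
noncomputable def tmul {M N : BanMod 𝒞 A} (x : M) (y : N) : tensor M N :=
  toComplete (E := PreTensor 𝒞 A M N) (x ⊗ₜ[A] y : M ⊗[A] N)

theorem norm_tmul_le {M N : BanMod 𝒞 A} (x : M) (y : N) : ‖tmul x y‖ ≤ ‖x‖ * ‖y‖ :=
  (norm_toComplete (E := PreTensor 𝒞 A M N) (x ⊗ₜ[A] y : M ⊗[A] N)).trans_le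
    (PreTensor.seminorm_tmul_le x y)

@[simp] theorem tensorLift_tmul {M N P : BanMod 𝒞 A} (B : M →ₗ[A] N →ₗ[A] P)
    (hB : ∃ C : ℝ≥0, ∀ x y, ‖B x y‖ ≤ C * (‖x‖ * ‖y‖)) (x : M) (y : N) :
    Hom.lin (tensorLift B hB) (tmul x y) = B x y :=
  (completeLift_coe (E := PreTensor 𝒞 A M N) _ _ _).trans (TensorProduct.lift.tmul x y)

theorem tensor_hom_ext {M N P : BanMod 𝒞 A} {f g : tensor M N ⟶ P}
    (h : ∀ x y, Hom.lin f (tmul x y) = Hom.lin g (tmul x y)) : f = g := by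
  refine complete_hom_ext (E := PreTensor 𝒞 A M N) fun t => ?_
  have : (Hom.lin f ∘ₗ toCompleteLin 𝒞 A (PreTensor 𝒞 A M N) : M ⊗[A] N →ₗ[A] P) =
      (Hom.lin g ∘ₗ toCompleteLin 𝒞 A (PreTensor 𝒞 A M N) : M ⊗[A] N →ₗ[A] P) :=
    TensorProduct.ext' h
  exact LinearMap.congr_fun this t

/-- The morphism `f ⊗̂ g`. -/
noncomputable def tensorMap {M M' N N' : BanMod 𝒞 A} (f : M ⟶ M') (g : N ⟶ N') :
    tensor M N ⟶ tensor M' N' :=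
  tensorLift
    (((TensorProduct.mk A M' N').compl₁₂ (Hom.lin f) (Hom.lin g)).compr₂
      (toCompleteLin 𝒞 A (PreTensor 𝒞 A M' N') : M' ⊗[A] N' →ₗ[A] tensor M' N')) <| by
    obtain ⟨C, hC⟩ := Hom.isBdd f
    obtain ⟨D, hD⟩ := Hom.isBdd g
    refine ⟨C * D, fun x y => (norm_tmul_le (Hom.lin f x) (Hom.lin g y)).trans ?_⟩
    rw [NNReal.coe_mul, mul_mul_mul_comm]
    exact mul_le_mul (hC x) (hD y) (norm_nonneg _) (mul_nonneg C.2 (norm_nonneg _))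

@[simp] theorem tensorMap_tmul {M M' N N' : BanMod 𝒞 A} (f : M ⟶ M') (g : N ⟶ N') (x : M) (y : N) :
    Hom.lin (tensorMap f g) (tmul x y) = tmul (Hom.lin f x) (Hom.lin g y) :=
  tensorLift_tmul _ _ x y

theorem tmul_add {M N : BanMod 𝒞 A} (x : M) (y y' : N) : tmul x (y + y') = tmul x y + tmul x y' :=
  (congrArg (toCompleteLin 𝒞 A (PreTensor 𝒞 A M N)) (TensorProduct.tmul_add x y y')).trans
    (map_add (toCompleteLin 𝒞 A (PreTensor 𝒞 A M N)) _ _)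

theorem add_tmul {M N : BanMod 𝒞 A} (x x' : M) (y : N) : tmul (x + x') y = tmul x y + tmul x' y :=
  (congrArg (toCompleteLin 𝒞 A (PreTensor 𝒞 A M N)) (TensorProduct.add_tmul x x' y)).trans
    (map_add (toCompleteLin 𝒞 A (PreTensor 𝒞 A M N)) _ _)

/-- The completed tensor product as a bifunctor. -/
noncomputable def tensorFunctor (𝒞 : Ambient) (A : Type u) [NormedCommRing A] :
    BanMod 𝒞 A ⥤ BanMod 𝒞 A ⥤ BanMod 𝒞 A where
  obj M :=
    { obj := fun N => tensor M N
      map := fun g => tensorMap (𝟙 M) g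
      map_id := fun N => tensor_hom_ext fun x y => by simp
      map_comp := fun f g => tensor_hom_ext fun x y => by simp }
  map f :=
    { app := fun N => tensorMap f (𝟙 N)
      naturality := fun N N' g => tensor_hom_ext fun x y => by simp }
  map_id M := by
    ext N
    exact tensor_hom_ext fun x y => by simp
  map_comp f g := by
    ext N
    exact tensor_hom_ext fun x y => by simp

theorem add_tensorMap {M M' N N' : BanMod 𝒞 A} (f f' : M ⟶ M') (g : N ⟶ N') :
    tensorMap (f + f') g = tensorMap f g + tensorMap f' g :=
  tensor_hom_ext fun x y => by
    rw [lin_add, tensorMap_tmul, tensorMap_tmul, tensorMap_tmul, lin_add, add_tmul]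

theorem tensorMap_add {M M' N N' : BanMod 𝒞 A} (f : M ⟶ M') (g g' : N ⟶ N') :
    tensorMap f (g + g') = tensorMap f g + tensorMap f g' :=
  tensor_hom_ext fun x y => by
    rw [lin_add, tensorMap_tmul, tensorMap_tmul, tensorMap_tmul, lin_add, tmul_add]

instance : (tensorFunctor 𝒞 A).Additive where
  map_add {_ _ f g} := by
    ext N
    exact add_tensorMap f g (𝟙 N)

instance (M : BanMod 𝒞 A) : ((tensorFunctor 𝒞 A).obj M).Additive where
  map_add {_ _ f g} := tensorMap_add (𝟙 M) f g

end BanMod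

/-! ## Free modules on normed sets and the functorial resolution -/

/-- The algebraic direct sum `⨁_{x ∈ M} A_{‖x‖}`, where `A_r` is the regular module with its norm
rescaled by `r`. -/
def PreFree (_𝒞 : Ambient) (A M : Type u) [NormedCommRing A] [NormedAddCommGroup M] : Type u :=
  M →₀ A

namespace PreFree

variable {𝒞 : Ambient} {A M : Type u} [NormedCommRing A] [NormedAddCommGroup M]

noncomputable instance : AddCommGroup (PreFree 𝒞 A M) := inferInstanceAs (AddCommGroup (M →₀ A))

noncomputable instance : Module A (PreFree 𝒞 A M) := inferInstanceAs (Module A (M →₀ A))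

/-- The underlying finitely supported function. -/
def toFinsupp (f : PreFree 𝒞 A M) : M →₀ A := f

/-- The `ℓ¹`-seminorm (resp. `ℓ^∞`-seminorm) with weights `‖x‖`. -/
noncomputable def seminorm (f : PreFree 𝒞 A M) : ℝ≥0 :=
  agg 𝒞 (toFinsupp f).support fun x => ‖toFinsupp f x‖₊ * ‖x‖₊

theorem seminorm_eq {f : PreFree 𝒞 A M} {s : Finset M} (hs : (toFinsupp f).support ⊆ s) :
    seminorm f = agg 𝒞 s fun x => ‖toFinsupp f x‖₊ * ‖x‖₊ :=
  (agg_subset hs _ fun x _ hx => by simp [Finsupp.notMem_support_iff.1 hx]).symm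

theorem seminorm_add_le [Ultra 𝒞 A] (f g : PreFree 𝒞 A M) :
    seminorm (f + g) ≤ comb 𝒞 (seminorm f) (seminorm g) := by
  classical
  rw [seminorm_eq (f := f + g) (s := (toFinsupp f).support ∪ (toFinsupp g).support)
      Finsupp.support_add,
    seminorm_eq (f := f) (s := (toFinsupp f).support ∪ (toFinsupp g).support)
      Finset.subset_union_left,
    seminorm_eq (f := g) (s := (toFinsupp f).support ∪ (toFinsupp g).support)
      Finset.subset_union_right]
  refine agg_comb_le _ _ _ _ fun x _ => ?_
  have h1 : toFinsupp (f + g) x = toFinsupp f x + toFinsupp g x := rfl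
  have h2 := nnnorm_add_le_comb (𝒞 := 𝒞) (toFinsupp f x) (toFinsupp g x)
  rw [h1]
  refine (mul_le_mul_left h2 _).trans ?_
  cases 𝒞
  · simp only [comb]
    rw [add_mul]
  · simp only [comb]
    rw [max_mul]

noncomputable instance [Ultra 𝒞 A] : SeminormedAddCommGroup (PreFree 𝒞 A M) :=
  AddGroupSeminorm.toSeminormedAddCommGroup
    { toFun := fun t => seminorm t
      map_zero' := by
        have : (toFinsupp (0 : PreFree 𝒞 A M)).support = ∅ := Finsupp.support_zero
        rw [seminorm, this]
        cases 𝒞 <;> simp [agg]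
      add_le' := fun s t => by
        exact_mod_cast (seminorm_add_le s t).trans (comb_le_add _ _)
      neg' := fun t => by
        have h : (toFinsupp (-t)).support = (toFinsupp t).support := Finsupp.support_neg _
        have h' : ∀ x, toFinsupp (-t) x = -toFinsupp t x := fun x => rfl
        simp only [seminorm, h, h', nnnorm_neg] }

instance [Ultra 𝒞 A] : Ultra 𝒞 (PreFree 𝒞 A M) := ultra_of_comb seminorm_add_le

instance [Ultra 𝒞 A] : BddSMul A (PreFree 𝒞 A M) where
  exists_bound := by
    refine ⟨1, fun a f => ?_⟩
    rw [NNReal.coe_one, one_mul]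
    suffices H : seminorm (a • f) ≤ ‖a‖₊ * seminorm f from H
    rw [seminorm_eq (f := a • f) (s := (toFinsupp f).support) Finsupp.support_smul]
    refine agg_le_mul _ _ _ _ fun x _ => ?_
    rw [← mul_assoc]
    exact mul_le_mul_left (nnnorm_mul_le a (toFinsupp f x)) _

end PreFree

namespace BanMod

variable {𝒞 : Ambient} {A : Type u} [NormedCommRing A] [Ultra 𝒞 A]

/-- The Banach module `ℓ(M, A)`: the completed direct sum of the `A_{‖x‖}`, `x ∈ M`. -/
noncomputable def free (M : BanMod 𝒞 A) : BanMod 𝒞 A := completeObj 𝒞 A (PreFree 𝒞 A M)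

/-- The counit `ℓ(M, A) → M`, sending the generator at `x` to `x`. -/
noncomputable def counit (M : BanMod 𝒞 A) : free M ⟶ M :=
  completeLift (E := PreFree 𝒞 A M) (Finsupp.linearCombination A (id : M → M)) <| by
    obtain ⟨C, hC⟩ := M.bddSMul.exists_bound
    refine ⟨C, fun f => ?_⟩
    have h : ‖Finsupp.linearCombination A (id : M → M) f‖₊ ≤ C * PreFree.seminorm f := by
      refine (nnnorm_sum_le_agg (𝒞 := 𝒞) _ _).trans (agg_le_mul _ _ _ _ fun x _ => ?_)
      rw [← mul_assoc]
      exact hC _ x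
    exact h

/-- The iterated kernels of the counits: `Z₀ = M` and `Zₙ₊₁ = ker (ℓ(Zₙ, A) → Zₙ)`. -/
noncomputable def syzygy (M : BanMod 𝒞 A) : ℕ → BanMod 𝒞 A
  | 0 => M
  | n + 1 => ker (counit (syzygy M n))

/-- The inclusion `Zₙ₊₁ → ℓ(Zₙ, A)`. -/
noncomputable def syzygyι (M : BanMod 𝒞 A) (n : ℕ) : syzygy M (n + 1) ⟶ free (syzygy M n) :=
  kerι (counit (syzygy M n))

theorem syzygyι_counit (M : BanMod 𝒞 A) (n : ℕ) : syzygyι M n ≫ counit (syzygy M n) = 0 :=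
  kerι_comp _

/-- The functorial projective resolution
`⋯ → ℓ(Z₂, A) → ℓ(Z₁, A) → ℓ(Z₀, A)` of `M = Z₀`. -/
noncomputable def resolution (M : BanMod 𝒞 A) : ChainComplex (BanMod 𝒞 A) ℕ :=
  ChainComplex.of (fun n => free (syzygy M n))
    (fun n => counit (syzygy M (n + 1)) ≫ syzygyι M n)
    (fun n => by
      rw [Category.assoc, ← Category.assoc (syzygyι M (n + 1)), syzygyι_counit, zero_comp,
        comp_zero])

/-- The augmentation of the resolution in degree `0`. -/
noncomputable def augmentation (M : BanMod 𝒞 A) : (resolution M).X 0 ⟶ M := counit M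

theorem resolution_d_augmentation (M : BanMod 𝒞 A) :
    (resolution M).d 1 0 ≫ augmentation M = 0 := by
  have h : (resolution M).d 1 0 = counit (syzygy M 1) ≫ syzygyι M 0 :=
    ChainComplex.of_d (fun n => free (syzygy M n))
      (fun n => counit (syzygy M (n + 1)) ≫ syzygyι M n) 0
  rw [h]
  exact (Category.assoc _ _ _).trans
    ((congrArg (counit (syzygy M 1) ≫ ·) (syzygyι_counit M 0)).trans comp_zero)

end BanMod

/-! ## The derived category -/

section Derived

variable {𝒞 : Ambient} {A : Type u} [NormedCommRing A]

/-- A complex of Banach modules is strictly exact if it is so in every degree. -/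
def StrictlyExact (K : CochainComplex (BanMod 𝒞 A) ℤ) : Prop :=
  ∀ i j k : ℤ, i + 1 = j → j + 1 = k → BanMod.StrictlyExactAt (K.d i j) (K.d j k)

/-- A morphism of complexes is a quasi-isomorphism if its mapping cone is strictly exact. -/
def IsQuasiIso {K L : CochainComplex (BanMod 𝒞 A) ℤ} (f : K ⟶ L) : Prop :=
  StrictlyExact (CochainComplex.mappingCone f)

/-- The complexes which are bounded above, in the homotopy category. -/
def boundedAbove (𝒞 : Ambient) (A : Type u) [NormedCommRing A] :
    ObjectProperty (HomotopyCategory (BanMod 𝒞 A) (ComplexShape.up ℤ)) :=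
  fun K => ∃ n : ℤ, CochainComplex.IsStrictlyLE K.as n

/-- The homotopy category of bounded above complexes of Banach modules. -/
abbrev KMinus (𝒞 : Ambient) (A : Type u) [NormedCommRing A] := (boundedAbove 𝒞 A).FullSubcategory

/-- The homotopy classes of quasi-isomorphisms. -/
def quasiIsos (𝒞 : Ambient) (A : Type u) [NormedCommRing A] : MorphismProperty (KMinus 𝒞 A) :=
  fun K L f => ∃ g : K.obj.as ⟶ L.obj.as,
    IsQuasiIso g ∧ (HomotopyCategory.quotient (BanMod 𝒞 A) (ComplexShape.up ℤ)).map g = f.hom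

/-- The bounded above derived category of Banach modules: the localization of the homotopy category
of bounded above complexes at the quasi-isomorphisms. -/
abbrev DMinus (𝒞 : Ambient) (A : Type u) [NormedCommRing A] := (quasiIsos 𝒞 A).Localization

/-- A chain complex `⋯ → X₂ → X₁ → X₀` regarded as an object of the homotopy category of bounded
above cochain complexes, with `Xₙ` in degree `-n`. -/
noncomputable def toKMinus (𝒞 : Ambient) (A : Type u) [NormedCommRing A] :
    ChainComplex (BanMod 𝒞 A) ℕ ⥤ KMinus 𝒞 A :=
  (boundedAbove 𝒞 A).lift
    (ComplexShape.embeddingDownNat.extendFunctor (BanMod 𝒞 A) ⋙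
      HomotopyCategory.quotient (BanMod 𝒞 A) (ComplexShape.up ℤ))
    (fun K => ⟨0, inferInstanceAs (CochainComplex.IsStrictlyLE
      (HomologicalComplex.extend K ComplexShape.embeddingDownNat) 0)⟩)

/-- A chain complex `⋯ → X₂ → X₁ → X₀` regarded as an object of the derived category. -/
noncomputable def toDMinus (𝒞 : Ambient) (A : Type u) [NormedCommRing A] :
    ChainComplex (BanMod 𝒞 A) ℕ ⥤ DMinus 𝒞 A :=
  toKMinus 𝒞 A ⋙ (quasiIsos 𝒞 A).Q

/-- A Banach module regarded as an object of the derived category, in degree `0`. -/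
noncomputable def moduleToDMinus (M : BanMod 𝒞 A) : DMinus 𝒞 A :=
  (toDMinus 𝒞 A).obj ((ChainComplex.single₀ (BanMod 𝒞 A)).obj M)

instance hasMapBifunctor (K L : ChainComplex (BanMod 𝒞 A) ℕ) :
    HomologicalComplex.HasMapBifunctor K L (BanMod.tensorFunctor 𝒞 A) (ComplexShape.down ℕ) :=
  fun n => by
    have : Finite ((ComplexShape.π (ComplexShape.down ℕ) (ComplexShape.down ℕ)
        (ComplexShape.down ℕ)) ⁻¹' {n}) :=
      Set.Finite.to_subtype ((Finset.finite_toSet (Finset.HasAntidiagonal.antidiagonal n)).subset fun p hp => by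
        simpa using hp)
    exact inferInstanceAs (HasCoproduct _)

theorem tensorMap_comp {M M' M'' N N' N'' : BanMod 𝒞 A} (f : M ⟶ M') (f' : M' ⟶ M'') (g : N ⟶ N')
    (g' : N' ⟶ N'') : BanMod.tensorMap f g ≫ BanMod.tensorMap f' g' =
      BanMod.tensorMap (f ≫ f') (g ≫ g') :=
  BanMod.tensor_hom_ext fun x y => by simp

theorem zero_tensorMap {M M' N N' : BanMod 𝒞 A} (g : N ⟶ N') :
    BanMod.tensorMap (0 : M ⟶ M') g = 0 := by
  have h := BanMod.add_tensorMap (0 : M ⟶ M') 0 g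
  rwa [add_zero, left_eq_add] at h

theorem tensorMap_zero {M M' N N' : BanMod 𝒞 A} (f : M ⟶ M') :
    BanMod.tensorMap f (0 : N ⟶ N') = 0 := by
  have h := BanMod.tensorMap_add f (0 : N ⟶ N') 0
  rwa [add_zero, left_eq_add] at h

variable [Ultra 𝒞 A]

/-- The total complex `Tot (P(M) ⊗̂_A P(N))`, where `P` is the functorial projective resolution. -/
noncomputable abbrev totTensor (M N : BanMod 𝒞 A) : ChainComplex (BanMod 𝒞 A) ℕ :=
  HomologicalComplex.mapBifunctor (BanMod.resolution M) (BanMod.resolution N)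
    (BanMod.tensorFunctor 𝒞 A) (ComplexShape.down ℕ)

/-- The derived tensor product `M ⊗̂ᴸ_A N` of Banach modules. -/
noncomputable def derivedTensor (M N : BanMod 𝒞 A) : DMinus 𝒞 A :=
  (toDMinus 𝒞 A).obj (totTensor M N)

/-- For a morphism `μ : M ⊗̂_A N → L`, the family of morphisms `P(M)ᵢ ⊗̂_A P(N)ⱼ → L` which is the
composite `P(M)₀ ⊗̂_A P(N)₀ → M ⊗̂_A N → L` for `i = j = 0` and zero otherwise. -/
noncomputable def totTensorComponent {M N L : BanMod 𝒞 A} (μ : BanMod.tensor M N ⟶ L) :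
    ∀ i j : ℕ, ((BanMod.tensorFunctor 𝒞 A).obj ((BanMod.resolution M).X i)).obj
      ((BanMod.resolution N).X j) ⟶ L
  | 0, 0 => BanMod.tensorMap (BanMod.augmentation M) (BanMod.augmentation N) ≫ μ
  | _ + 1, _ => 0
  | 0, _ + 1 => 0

/-- The degree `0` part of the morphism `Tot (P(M) ⊗̂_A P(N)) → L` induced by `μ`. -/
noncomputable def totTensorDesc {M N L : BanMod 𝒞 A} (μ : BanMod.tensor M N ⟶ L) :
    (totTensor M N).X 0 ⟶ L :=
  HomologicalComplex.mapBifunctorDesc fun i j _ => totTensorComponent μ i j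

theorem totTensor_d_desc {M N L : BanMod 𝒞 A} (μ : BanMod.tensor M N ⟶ L) :
    (totTensor M N).d 1 0 ≫ totTensorDesc μ = 0 := by
  refine HomologicalComplex.mapBifunctor.hom_ext fun i j h => ?_
  have h' : i + j = 1 := h
  rw [comp_zero]
  change HomologicalComplex.ιMapBifunctor _ _ _ _ i j 1 h ≫
    (HomologicalComplex.mapBifunctor.D₁ _ _ _ _ 1 0 +
      HomologicalComplex.mapBifunctor.D₂ _ _ _ _ 1 0) ≫ totTensorDesc μ = 0
  rw [Preadditive.add_comp, Preadditive.comp_add,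
    HomologicalComplex.mapBifunctor.ι_D₁_assoc, HomologicalComplex.mapBifunctor.ι_D₂_assoc]
  obtain ⟨rfl, rfl⟩ | ⟨rfl, rfl⟩ : (i = 1 ∧ j = 0) ∨ (i = 0 ∧ j = 1) := by omega
  · rw [HomologicalComplex.mapBifunctor.d₁_eq _ _ _ _ (i₁ := 1) (i₁' := 0) (by simp) 0 0 rfl,
      HomologicalComplex.mapBifunctor.d₂_eq_zero _ _ _ _ 1 0 0 (by simp), zero_comp, add_zero,
      Linear.units_smul_comp, Category.assoc, totTensorDesc,
      HomologicalComplex.ι_mapBifunctorDesc]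
    refine (congrArg _ ?_).trans (smul_zero _)
    change BanMod.tensorMap _ (𝟙 _) ≫ BanMod.tensorMap _ _ ≫ μ = 0
    rw [← Category.assoc, tensorMap_comp, BanMod.resolution_d_augmentation, zero_tensorMap,
      zero_comp]
  · rw [HomologicalComplex.mapBifunctor.d₂_eq _ _ _ _ 0 (i₂ := 1) (i₂' := 0) (by simp) 0 rfl,
      HomologicalComplex.mapBifunctor.d₁_eq_zero _ _ _ _ 0 1 0 (by simp), zero_comp, zero_add,
      Linear.units_smul_comp, Category.assoc, totTensorDesc,
      HomologicalComplex.ι_mapBifunctorDesc]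
    refine (congrArg _ ?_).trans (smul_zero _)
    change BanMod.tensorMap (𝟙 _) _ ≫ BanMod.tensorMap _ _ ≫ μ = 0
    rw [← Category.assoc, tensorMap_comp, BanMod.resolution_d_augmentation, tensorMap_zero,
      zero_comp]

/-- The morphism `Tot (P(M) ⊗̂_A P(N)) → L` of complexes induced by `μ : M ⊗̂_A N → L`. -/
noncomputable def totTensorMap {M N L : BanMod 𝒞 A} (μ : BanMod.tensor M N ⟶ L) :
    totTensor M N ⟶ (ChainComplex.single₀ (BanMod 𝒞 A)).obj L :=
  (ChainComplex.toSingle₀Equiv (totTensor M N) L).symm ⟨totTensorDesc μ, totTensor_d_desc μ⟩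

/-- The morphism `M ⊗̂ᴸ_A N → L` in the derived category induced by `μ : M ⊗̂_A N → L`. -/
noncomputable def derivedTensorMap {M N L : BanMod 𝒞 A} (μ : BanMod.tensor M N ⟶ L) :
    derivedTensor M N ⟶ moduleToDMinus L :=
  (toDMinus 𝒞 A).map (totTensorMap μ)

end Derived

/-! ## Banach algebras and homotopy epimorphisms -/

/-- A Banach `R`-algebra in the ambient category `𝒞`: a commutative `R`-algebra with a complete norm,
ultrametric if `𝒞 = nonarch`, such that the multiplication and the scalar multiplication are bounded.
Every Banach ring is isomorphic to one with submultiplicative norm, and we take the norm to be such. -/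
structure BanAlg (𝒞 : Ambient) (R : Type v) [NormedCommRing R] where
  carrier : Type u
  [normedCommRing : NormedCommRing carrier]
  [algebra : Algebra R carrier]
  [bddSMul : BddSMul R carrier]
  [complete : CompleteSpace carrier]
  [ultra : Ultra 𝒞 carrier]

namespace BanAlg

variable {𝒞 : Ambient} {R : Type v} [NormedCommRing R]

instance : CoeSort (BanAlg.{u} 𝒞 R) (Type u) := ⟨carrier⟩

attribute [instance] normedCommRing algebra bddSMul complete ultra

/-- The category of Banach `R`-algebras and bounded `R`-algebra homomorphisms. -/
instance : Category (BanAlg.{u} 𝒞 R) where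
  Hom A B := {f : A →ₐ[R] B // IsBdd f}
  id A := ⟨AlgHom.id R A, 1, by simp⟩
  comp f g := ⟨g.1.comp f.1, by
    obtain ⟨C, hC⟩ := f.2
    obtain ⟨D, hD⟩ := g.2
    refine ⟨D * C, fun x => (hD _).trans ?_⟩
    rw [NNReal.coe_mul, mul_assoc]
    exact mul_le_mul_of_nonneg_left (hC x) D.2⟩

/-- The algebra homomorphism underlying a morphism. -/
def Hom.alg {A B : BanAlg.{u} 𝒞 R} (π : A ⟶ B) : A →ₐ[R] B := π.1

/-- The target of a morphism `π : A → B` as a Banach `A`-module via `π`. -/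
def asModule {A B : BanAlg.{u} 𝒞 R} (π : A ⟶ B) : BanMod 𝒞 A :=
  letI : Module A B := (Hom.alg π).toRingHom.toModule
  { carrier := B
    bddSMul := by
      obtain ⟨C, hC⟩ := π.2
      refine ⟨C, fun a b => (norm_mul_le (Hom.alg π a) b).trans ?_⟩
      exact mul_le_mul_of_nonneg_right (hC a) (norm_nonneg b) }

/-- The multiplication `B ⊗̂_A B → B`. -/
noncomputable def mul {A B : BanAlg.{u} 𝒞 R} (π : A ⟶ B) :
    BanMod.tensor (asModule π) (asModule π) ⟶ asModule π :=
  BanMod.tensorLift (M := asModule π) (N := asModule π) (P := asModule π)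
    (LinearMap.mk₂ A (fun x y : B => (x * y : B))
      (fun x x' y => add_mul (R := B) x x' y)
      (fun a x y => mul_assoc (G := B) (Hom.alg π a) x y)
      (fun x y y' => mul_add (R := B) x y y')
      (fun a x y => mul_left_comm (G := B) x (Hom.alg π a) y))
    ⟨1, fun x y => (norm_mul_le (α := B) x y).trans_eq (one_mul _).symm⟩

/-- A morphism `π : A → B` of Banach `R`-algebras is a homotopy epimorphism if the multiplication
`B ⊗̂ᴸ_A B → B` is an isomorphism in the bounded above derived category of Banach `A`-modules. -/
def IsHomotopyEpi {A B : BanAlg.{u} 𝒞 R} (π : A ⟶ B) : Prop :=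
  IsIso (derivedTensorMap (mul π))

end BanAlg

/-! ## Algebras of continuous functions -/

section ContinuousFunctions

variable (𝒞 : Ambient) (R : Type v) [NormedField R] [CompleteSpace R] [Ultra 𝒞 R]

/-- The Banach `R`-algebra `C(X, R)` with the supremum norm. -/
noncomputable def contAlg (X : Type u) [TopologicalSpace X] [CompactSpace X] : BanAlg.{max u v} 𝒞 R where
  carrier := C(X, R)
  bddSMul := ⟨1, fun a f => by simpa using norm_smul_le a f⟩
  ultra := ⟨fun h => by
    have := Ultra.isUltrametricDist (𝒞 := 𝒞) (E := R) h
    infer_instance⟩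

variable {X : Type u} [TopologicalSpace X] [CompactSpace X]

instance (K : TopologicalSpace.Closeds X) : CompactSpace K :=
  isCompact_iff_compactSpace.1 K.isClosed.isCompact

/-- The restriction map `C(X, R) → C(K, R)` for a closed subset `K` of `X`. -/
noncomputable def restriction (K : TopologicalSpace.Closeds X) : contAlg 𝒞 R X ⟶ contAlg 𝒞 R K :=
  ⟨ContinuousMap.compRightAlgHom R R ⟨(Subtype.val : K → X), continuous_subtype_val⟩, 1, fun f => by
    rw [NNReal.coe_one, one_mul]
    exact (ContinuousMap.norm_le _ (norm_nonneg f)).2 fun x => ContinuousMap.norm_coe_le_norm f x.1⟩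

end ContinuousFunctions

/-! ## Admissible triples -/

/-- A non-Archimedean local field: a normed field whose norm is ultrametric and non-trivial and whose
topology is locally compact. -/
def IsNonarchLocalField (R : Type v) [NormedField R] : Prop :=
  IsUltrametricDist R ∧ (∃ x : R, x ≠ 0 ∧ ‖x‖ ≠ 1) ∧ LocallyCompactSpace R

/-- The admissible pairs: `R` is `ℝ` or `ℂ` with the usual absolute value in the Archimedean case, and
a finite field with trivial norm or a local field in the non-Archimedean case. -/
def IsAdmissiblePair (𝒞 : Ambient) (R : Type v) [NormedField R] : Prop :=
  match 𝒞 with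
  | .arch => (∃ e : R ≃+* ℝ, ∀ x, ‖e x‖ = ‖x‖) ∨ (∃ e : R ≃+* ℂ, ∀ x, ‖e x‖ = ‖x‖)
  | .nonarch => (Finite R ∧ ∀ x : R, x ≠ 0 → ‖x‖ = 1) ∨ IsNonarchLocalField R

/-- The admissible triples: moreover `X` is totally disconnected in the non-Archimedean case. -/
def IsAdmissibleTriple (𝒞 : Ambient) (X : Type u) [TopologicalSpace X] (R : Type v)
    [NormedField R] : Prop :=
  IsAdmissiblePair 𝒞 R ∧ (𝒞 = .nonarch → TotallyDisconnectedSpace X)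

end BanachGeometry

namespace BanachGeometry

namespace BanMod

variable {𝒞 : Ambient} {A : Type u} [NormedCommRing A]

/-! ## Quantitative exactness -/

/-- Exactness at `N` with bounded preimages. -/
def BddExact {M N P : BanMod 𝒞 A} (f : M ⟶ N) (g : N ⟶ P) : Prop :=
  f ≫ g = 0 ∧ ∃ C : ℝ≥0, ∀ y, Hom.lin g y = 0 → ∃ x, Hom.lin f x = y ∧ ‖x‖ ≤ C * ‖y‖

/-- Exactness at `N` with a bound on the distance of `y` to the image of `f` in terms of `g y`: this
amounts to exactness with bounded preimages and strictness of `g`. -/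
def RelExact {M N P : BanMod 𝒞 A} (f : M ⟶ N) (g : N ⟶ P) : Prop :=
  f ≫ g = 0 ∧ ∃ C : ℝ≥0, ∀ y, ∃ x, ‖x‖ ≤ C * ‖y‖ ∧ ‖y - Hom.lin f x‖ ≤ C * ‖Hom.lin g y‖

/-- The variant of `RelExact` up to arbitrarily small errors. -/
def ApproxExact {M N P : BanMod 𝒞 A} (f : M ⟶ N) (g : N ⟶ P) : Prop :=
  f ≫ g = 0 ∧ ∃ C : ℝ≥0, ∀ y, ∀ ε : ℝ, 0 < ε →
    ∃ x, ‖x‖ ≤ C * ‖y‖ + ε ∧ ‖y - Hom.lin f x‖ ≤ C * ‖Hom.lin g y‖ + ε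

theorem lin_lin_eq_zero {M N P : BanMod 𝒞 A} {f : M ⟶ N} {g : N ⟶ P} (h : f ≫ g = 0) (x : M) :
    Hom.lin g (Hom.lin f x) = 0 := by
  rw [← lin_comp, h, lin_zero]

theorem BddExact.strictlyExactAt {M N P : BanMod 𝒞 A} {f : M ⟶ N} {g : N ⟶ P}
    (h : BddExact f g) : StrictlyExactAt f g := by
  obtain ⟨h0, C, hC⟩ := h
  have hr : Set.range (Hom.lin f) = {y | Hom.lin g y = 0} := by
    ext y
    constructor
    · rintro ⟨x, rfl⟩
      exact lin_lin_eq_zero h0 x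
    · intro hy
      obtain ⟨x, hx, -⟩ := hC y hy
      exact ⟨x, hx⟩
  have hcl : IsClosed (Set.range (Hom.lin f)) := by
    rw [hr]
    exact isClosed_singleton.preimage (continuous_lin g)
  refine ⟨⟨hcl, C, fun x => hC _ (lin_lin_eq_zero h0 x)⟩, ?_⟩
  rw [hcl.closure_eq, hr]

theorem exists_preimage_of_approx {M N : BanMod 𝒞 A} (f : M ⟶ N) (s : Set N)
    (hs : ∀ y ∈ s, ∀ x, y - Hom.lin f x ∈ s) (D : ℝ≥0)
    (h : ∀ y ∈ s, ∃ x, ‖x‖ ≤ D * ‖y‖ ∧ ‖y - Hom.lin f x‖ ≤ ‖y‖ * (1 / 2)) (y : N) (hy : y ∈ s) :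
    ∃ x, Hom.lin f x = y ∧ ‖x‖ ≤ (D * 2 : ℝ≥0) * ‖y‖ := by
  classical
  choose! φ hφ using h
  let Y : ℕ → N := fun n => (fun y => y - Hom.lin f (φ y))^[n] y
  have hsucc : ∀ n, Y (n + 1) = Y n - Hom.lin f (φ (Y n)) := fun n =>
    Function.iterate_succ_apply' _ n y
  have hmem : ∀ n, Y n ∈ s := by
    intro n
    induction n with
    | zero => exact hy
    | succ n ih =>
      rw [hsucc]
      exact hs _ ih _
  have hY : ∀ n, ‖Y n‖ ≤ ‖y‖ * (1 / 2) ^ n := by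
    intro n
    induction n with
    | zero => simp [Y]
    | succ n ih =>
      rw [hsucc, pow_succ, ← mul_assoc]
      exact (hφ _ (hmem n)).2.trans (mul_le_mul_of_nonneg_right ih (by norm_num))
  have hx : ∀ n, ‖φ (Y n)‖ ≤ D * ‖y‖ * (1 / 2) ^ n := fun n =>
    (hφ _ (hmem n)).1.trans (by
      rw [mul_assoc]
      exact mul_le_mul_of_nonneg_left (hY n) D.2)
  have hg : HasSum (fun n : ℕ => D * ‖y‖ * (1 / 2) ^ n) (D * ‖y‖ * 2) :=
    hasSum_geometric_two.mul_left _
  have hsum : Summable (fun n => φ (Y n)) := Summable.of_norm_bounded hg.summable hx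
  refine ⟨∑' n, φ (Y n), ?_, ?_⟩
  · have h1 : Filter.Tendsto (fun n => Hom.lin f (∑ i ∈ Finset.range n, φ (Y i))) Filter.atTop
        (nhds (Hom.lin f (∑' n, φ (Y n)))) :=
      ((continuous_lin f).tendsto _).comp hsum.hasSum.tendsto_sum_nat
    have h2 : ∀ n, Hom.lin f (∑ i ∈ Finset.range n, φ (Y i)) = y - Y n := by
      intro n
      induction n with
      | zero => simp [Y]
      | succ n ih =>
        rw [Finset.sum_range_succ, map_add, ih, hsucc]
        abel
    have h3 : Filter.Tendsto Y Filter.atTop (nhds 0) := by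
      refine squeeze_zero_norm hY ?_
      have := (tendsto_pow_atTop_nhds_zero_of_lt_one (r := (1 / 2 : ℝ)) (by norm_num)
        (by norm_num)).const_mul ‖y‖
      simpa using this
    have h4 : Filter.Tendsto (fun n => y - Y n) Filter.atTop (nhds (y - 0)) :=
      tendsto_const_nhds.sub h3
    rw [sub_zero] at h4
    simp only [h2] at h1
    exact tendsto_nhds_unique h1 h4
  · refine (tsum_of_norm_bounded hg hx).trans (le_of_eq ?_)
    push_cast
    ring

theorem ApproxExact.bddExact {M N P : BanMod 𝒞 A} {f : M ⟶ N} {g : N ⟶ P}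
    (h : ApproxExact f g) : BddExact f g := by
  obtain ⟨h0, C, hC⟩ := h
  refine ⟨h0, (C + 1) * 2, fun y hy => ?_⟩
  refine exists_preimage_of_approx f {y | Hom.lin g y = 0} (fun y hy x => ?_) (C + 1)
    (fun y hy => ?_) y hy
  · change Hom.lin g _ = 0
    rw [map_sub, lin_lin_eq_zero h0, sub_zero]
    exact hy
  · by_cases hy0 : y = 0
    · exact ⟨0, by simp [hy0], by simp [hy0]⟩
    · have hpos : 0 < ‖y‖ := norm_pos_iff.2 hy0
      obtain ⟨x, hx1, hx2⟩ := hC y (‖y‖ * (1 / 2)) (by positivity)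
      refine ⟨x, hx1.trans ?_, hx2.trans (le_of_eq ?_)⟩
      · push_cast
        linarith
      · rw [show Hom.lin g y = 0 from hy, norm_zero, mul_zero, zero_add]

theorem ApproxExact.of_dense {M N P : BanMod 𝒞 A} {f : M ⟶ N} {g : N ⟶ P} (h0 : f ≫ g = 0)
    {s : Set N} (hs : Dense s) (C : ℝ≥0)
    (h : ∀ y ∈ s, ∀ ε : ℝ, 0 < ε →
      ∃ x, ‖x‖ ≤ C * ‖y‖ + ε ∧ ‖y - Hom.lin f x‖ ≤ C * ‖Hom.lin g y‖ + ε) :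
    ApproxExact f g := by
  refine ⟨h0, C, fun y ε hε => ?_⟩
  obtain ⟨L, hL⟩ := Hom.isBdd g
  have hpos : (0 : ℝ) < 1 + C + C * L := by positivity
  set η : ℝ := ε / 2 / (1 + C + C * L) with hη
  have hηpos : 0 < η := by positivity
  have hηeq : η * (1 + C + C * L) = ε / 2 := by
    rw [hη]
    field_simp
  obtain ⟨y', hy', hd⟩ := Metric.dense_iff.1 hs y η hηpos
  have hd : ‖y' - y‖ ≤ η := by
    rw [← dist_eq_norm]
    exact (Metric.mem_ball.1 hy').le
  obtain ⟨x, hx1, hx2⟩ := h y' ‹_› (ε / 2) (half_pos hε)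
  have e1 : ‖y'‖ ≤ ‖y‖ + η := by
    have := norm_add_le y (y' - y)
    rw [add_sub_cancel] at this
    linarith
  have e2 : ‖Hom.lin g y'‖ ≤ ‖Hom.lin g y‖ + L * η := by
    have := norm_add_le (Hom.lin g y) (Hom.lin g (y' - y))
    rw [← map_add, add_sub_cancel] at this
    have := hL (y' - y)
    have := mul_le_mul_of_nonneg_left hd L.2
    simp only [NNReal.val_eq_coe] at this
    linarith
  have e3 : ‖y - Hom.lin f x‖ ≤ η + ‖y' - Hom.lin f x‖ := by
    have := norm_add_le (y - y') (y' - Hom.lin f x)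
    rw [sub_add_sub_cancel, norm_sub_rev y y'] at this
    linarith
  have e4 := mul_le_mul_of_nonneg_left e1 C.2
  have e5 := mul_le_mul_of_nonneg_left e2 C.2
  simp only [NNReal.val_eq_coe] at e4 e5
  have p1 : 0 ≤ C * η := by positivity
  have p2 : 0 ≤ C * (L * η) := by positivity
  refine ⟨x, ?_, ?_⟩ <;> nlinarith

theorem RelExact.comp_kerι {M N P Q : BanMod 𝒞 A} {f : M ⟶ N} {h : P ⟶ Q} {g : N ⟶ ker h}
    (hfg : RelExact f g) : RelExact f (g ≫ kerι h) := by
  obtain ⟨h0, C, hC⟩ := hfg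
  exact ⟨by rw [← Category.assoc, h0, zero_comp], C, hC⟩

/-! ## Exactness of the functorial resolution -/

section Resolution

variable [Ultra 𝒞 A]

/-- The generator of `ℓ(M, A)` at `x`. -/
noncomputable def gen {M : BanMod 𝒞 A} (x : M) : free M :=
  toComplete (E := PreFree 𝒞 A M) (Finsupp.single x 1 : M →₀ A)

theorem norm_gen_le {M : BanMod 𝒞 A} (x : M) : ‖gen x‖ ≤ ‖(1 : A)‖₊ * ‖x‖ := by
  refine (norm_toComplete (E := PreFree 𝒞 A M) (Finsupp.single x 1 : M →₀ A)).trans_le ?_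
  have h := PreFree.seminorm_eq (𝒞 := 𝒞) (f := (Finsupp.single x 1 : M →₀ A)) (s := {x})
    Finsupp.support_single_subset
  have h1 : PreFree.toFinsupp (𝒞 := 𝒞) (Finsupp.single x 1 : M →₀ A) x = 1 :=
    Finsupp.single_eq_same
  refine (congrArg NNReal.toReal h).trans_le ?_
  cases 𝒞 <;> simp [agg, h1]

theorem counit_gen {M : BanMod 𝒞 A} (x : M) : Hom.lin (counit M) (gen x) = x := by
  refine (completeLift_coe (E := PreFree 𝒞 A M) _ _ _).trans ?_
  exact (Finsupp.linearCombination_single A 1 x).trans (one_smul A x)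

theorem exists_counit_eq (M : BanMod 𝒞 A) (x : M) :
    ∃ p, Hom.lin (counit M) p = x ∧ ‖p‖ ≤ ‖(1 : A)‖₊ * ‖x‖ :=
  ⟨gen x, counit_gen x, norm_gen_le x⟩

theorem relExact_counit (M : BanMod 𝒞 A) :
    RelExact (counit (ker (counit M)) ≫ kerι (counit M)) (counit M) := by
  refine ⟨by rw [Category.assoc, kerι_comp, comp_zero], ?_⟩
  obtain ⟨L, hL⟩ := Hom.isBdd (counit M)
  set c : ℝ≥0 := ‖(1 : A)‖₊
  refine ⟨max c (c * (1 + c * L)), fun p => ?_⟩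
  have hk : p - gen (Hom.lin (counit M) p) ∈ LinearMap.ker (Hom.lin (counit M)) := by
    rw [LinearMap.mem_ker, map_sub, counit_gen, sub_self]
  let z : ker (counit M) := ⟨_, hk⟩
  have hz : ‖z‖ ≤ (1 + c * L) * ‖p‖ := by
    have h1 : ‖z‖ ≤ ‖p‖ + ‖gen (Hom.lin (counit M) p)‖ :=
      norm_sub_le p (gen (Hom.lin (counit M) p))
    have h2 : _ ≤ (c : ℝ) * _ := norm_gen_le (Hom.lin (counit M) p)
    have h3 := mul_le_mul_of_nonneg_left (hL p) c.2
    simp only [NNReal.val_eq_coe] at h3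
    linarith
  refine ⟨gen z, (norm_gen_le z).trans ?_, ?_⟩
  · refine (mul_le_mul_of_nonneg_left hz c.2).trans ?_
    rw [← mul_assoc]
    refine mul_le_mul_of_nonneg_right ?_ (norm_nonneg p)
    exact_mod_cast le_max_right c (c * (1 + c * L))
  · have h1 : Hom.lin (counit (ker (counit M)) ≫ kerι (counit M)) (gen z) =
        p - gen (Hom.lin (counit M) p) := by
      rw [lin_comp, counit_gen]
      rfl
    rw [h1, sub_sub_cancel]
    refine (norm_gen_le _).trans (mul_le_mul_of_nonneg_right ?_ (norm_nonneg _))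
    exact_mod_cast le_max_left c (c * (1 + c * L))

theorem resolution_d (M : BanMod 𝒞 A) (n : ℕ) :
    (resolution M).d (n + 1) n = counit (syzygy M (n + 1)) ≫ syzygyι M n :=
  ChainComplex.of_d (fun n => free (syzygy M n))
    (fun n => counit (syzygy M (n + 1)) ≫ syzygyι M n) n

theorem relExact_resolution (M : BanMod 𝒞 A) (n : ℕ) :
    RelExact ((resolution M).d (n + 2) (n + 1)) ((resolution M).d (n + 1) n) := by
  rw [resolution_d, resolution_d]
  exact (relExact_counit (syzygy M (n + 1))).comp_kerι

theorem relExact_augmentation (M : BanMod 𝒞 A) :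
    RelExact ((resolution M).d 1 0) (augmentation M) := by
  rw [resolution_d]
  exact relExact_counit M

end Resolution

end BanMod

end BanachGeometry

namespace BanachGeometry

/-! ## Completed tensor products with free modules -/

/-- The algebraic direct sum of copies of `M` indexed by `Z`, with norms rescaled by `‖z‖`. -/
def PreSum (_𝒞 : Ambient) (Z M : Type u) [NormedAddCommGroup Z] [NormedAddCommGroup M] : Type u :=
  Z →₀ M

namespace PreSum

variable {𝒞 : Ambient} {A Z M : Type u} [NormedCommRing A] [NormedAddCommGroup Z]
  [NormedAddCommGroup M] [Module A M]

noncomputable instance : AddCommGroup (PreSum 𝒞 Z M) := inferInstanceAs (AddCommGroup (Z →₀ M))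

noncomputable instance : Module A (PreSum 𝒞 Z M) := inferInstanceAs (Module A (Z →₀ M))

/-- The underlying finitely supported function. -/
def toFinsupp (f : PreSum 𝒞 Z M) : Z →₀ M := f

/-- The weighted `ℓ¹`-seminorm (resp. `ℓ^∞`-seminorm). -/
noncomputable def seminorm (f : PreSum 𝒞 Z M) : ℝ≥0 :=
  agg 𝒞 (toFinsupp f).support fun z => ‖toFinsupp f z‖₊ * ‖z‖₊

theorem seminorm_eq {f : PreSum 𝒞 Z M} {s : Finset Z} (hs : (toFinsupp f).support ⊆ s) :
    seminorm f = agg 𝒞 s fun z => ‖toFinsupp f z‖₊ * ‖z‖₊ :=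
  (agg_subset hs _ fun x _ hx => by simp [Finsupp.notMem_support_iff.1 hx]).symm

theorem seminorm_add_le [Ultra 𝒞 M] (f g : PreSum 𝒞 Z M) :
    seminorm (f + g) ≤ comb 𝒞 (seminorm f) (seminorm g) := by
  classical
  rw [seminorm_eq (f := f + g) (s := (toFinsupp f).support ∪ (toFinsupp g).support)
      Finsupp.support_add,
    seminorm_eq (f := f) (s := (toFinsupp f).support ∪ (toFinsupp g).support)
      Finset.subset_union_left,
    seminorm_eq (f := g) (s := (toFinsupp f).support ∪ (toFinsupp g).support)
      Finset.subset_union_right]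
  refine agg_comb_le _ _ _ _ fun z _ => ?_
  have h1 : toFinsupp (f + g) z = toFinsupp f z + toFinsupp g z := rfl
  rw [h1]
  refine (mul_le_mul_left (nnnorm_add_le_comb (𝒞 := 𝒞) (toFinsupp f z) (toFinsupp g z)) _).trans ?_
  cases 𝒞
  · simp only [comb]
    rw [add_mul]
  · simp only [comb]
    rw [max_mul]

noncomputable instance [Ultra 𝒞 M] : SeminormedAddCommGroup (PreSum 𝒞 Z M) :=
  AddGroupSeminorm.toSeminormedAddCommGroup
    { toFun := fun t => seminorm t
      map_zero' := by
        have : (toFinsupp (0 : PreSum 𝒞 Z M)).support = ∅ := Finsupp.support_zero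
        rw [seminorm, this]
        cases 𝒞 <;> simp [agg]
      add_le' := fun s t => by
        exact_mod_cast (seminorm_add_le s t).trans (comb_le_add _ _)
      neg' := fun t => by
        have h : (toFinsupp (-t)).support = (toFinsupp t).support := Finsupp.support_neg _
        have h' : ∀ x, toFinsupp (-t) x = -toFinsupp t x := fun x => rfl
        simp only [seminorm, h, h', nnnorm_neg] }

instance [Ultra 𝒞 M] : Ultra 𝒞 (PreSum 𝒞 Z M) := ultra_of_comb seminorm_add_le

theorem seminorm_le_mul {E F : Type u} [NormedAddCommGroup E] [NormedAddCommGroup F]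
    {v : PreSum 𝒞 Z E} {w : PreSum 𝒞 Z F} {C : ℝ≥0}
    (h : ∀ z, ‖toFinsupp v z‖₊ ≤ C * ‖toFinsupp w z‖₊) : seminorm v ≤ C * seminorm w := by
  classical
  rw [seminorm_eq (f := v) (s := (toFinsupp v).support ∪ (toFinsupp w).support)
      Finset.subset_union_left,
    seminorm_eq (f := w) (s := (toFinsupp v).support ∪ (toFinsupp w).support)
      Finset.subset_union_right]
  refine agg_le_mul _ _ _ _ fun z _ => ?_
  rw [← mul_assoc]
  exact mul_le_mul_left (h z) _

instance [Ultra 𝒞 M] [h : BddSMul A M] : BddSMul A (PreSum 𝒞 Z M) where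
  exists_bound := by
    obtain ⟨C, hC⟩ := h.exists_bound
    refine ⟨C, fun a f => ?_⟩
    have H : seminorm (a • f) ≤ C * ‖a‖₊ * seminorm f :=
      seminorm_le_mul fun z => hC a (toFinsupp f z)
    exact H

end PreSum

namespace BanMod

variable {𝒞 : Ambient} {A : Type u} [NormedCommRing A] [Ultra 𝒞 A]

/-- The sum `∑ [z] ⊗ w z` in `ℓ(Z, A) ⊗̂ M`. -/
noncomputable def genSum (Z M : BanMod 𝒞 A) : (Z →₀ M) →+ tensor (free Z) M :=
  Finsupp.liftAddHom fun z =>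
    { toFun := fun m => tmul (gen z) m
      map_zero' := by simpa using tmul_add (gen z) (0 : M) 0
      map_add' := tmul_add (gen z) }

theorem genSum_apply {Z M : BanMod 𝒞 A} (w : Z →₀ M) :
    genSum Z M w = ∑ z ∈ w.support, tmul (gen z) (w z) := rfl

theorem genSum_single {Z M : BanMod 𝒞 A} (z : Z) (m : M) :
    genSum Z M (Finsupp.single z m) = tmul (gen z) m :=
  Finsupp.liftAddHom_apply_single _ z m

theorem norm_genSum_le {Z M : BanMod 𝒞 A} (w : Z →₀ M) :
    ‖genSum Z M w‖ ≤ ‖(1 : A)‖₊ * PreSum.seminorm (𝒞 := 𝒞) w := by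
  have h : ‖genSum Z M w‖₊ ≤ ‖(1 : A)‖₊ * PreSum.seminorm (𝒞 := 𝒞) w := by
    rw [genSum_apply]
    refine (nnnorm_sum_le_agg (𝒞 := 𝒞) _ _).trans (agg_le_mul _ _ _ _ fun z _ => ?_)
    have h1 : ‖tmul (gen z) (w z)‖₊ ≤ ‖gen z‖₊ * ‖w z‖₊ := norm_tmul_le _ _
    have h2 : ‖gen z‖₊ ≤ ‖(1 : A)‖₊ * ‖z‖₊ := norm_gen_le z
    refine h1.trans ((mul_le_mul_left h2 _).trans (le_of_eq ?_))
    change _ = ‖(1 : A)‖₊ * (‖w z‖₊ * ‖z‖₊)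
    ring
  exact h

theorem genSum_mapRange {Z M N : BanMod 𝒞 A} (f : M ⟶ N) (w : Z →₀ M) :
    genSum Z N (Finsupp.mapRange (Hom.lin f) (map_zero _) w) =
      Hom.lin (tensorMap (𝟙 (free Z)) f) (genSum Z M w) := by
  induction w using Finsupp.induction_linear with
  | zero => rw [Finsupp.mapRange_zero, map_zero, map_zero, map_zero]
  | add v w hv hw => rw [Finsupp.mapRange_add (map_add _), map_add, map_add, map_add, hv, hw]
  | single z m =>
    rw [Finsupp.mapRange_single, genSum_single, genSum_single, tensorMap_tmul, lin_id]

theorem freeToSum_bound {Z M : BanMod 𝒞 A} {C : ℝ≥0}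
    (hC : ∀ (a : A) (m : M), ‖a • m‖ ≤ C * ‖a‖ * ‖m‖) (m : M) (f : PreFree 𝒞 A Z) :
    ‖(toCompleteLin 𝒞 A (PreSum 𝒞 Z M) ∘ₗ
      (Finsupp.mapRange.linearMap (LinearMap.toSpanSingleton A M m) :
        (Z →₀ A) →ₗ[A] (Z →₀ M))) f‖ ≤ (C * ‖m‖₊ : ℝ≥0) * ‖f‖ := by
  refine (norm_toComplete (E := PreSum 𝒞 Z M) _).trans_le ?_
  have H := PreSum.seminorm_le_mul (𝒞 := 𝒞) (C := C * ‖m‖₊)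
    (v := Finsupp.mapRange.linearMap (LinearMap.toSpanSingleton A M m) f)
    (w := (f : Z →₀ A)) fun z => by
      have h : ‖PreFree.toFinsupp f z • m‖₊ ≤ C * ‖PreFree.toFinsupp f z‖₊ * ‖m‖₊ := hC _ m
      rw [mul_right_comm] at h
      exact h
  exact H

/-- The map `ℓ(Z, A) → ⨁̂_z M` sending `[z]` to `m` placed at `z`. -/
noncomputable def freeToSum (Z : BanMod 𝒞 A) {M : BanMod 𝒞 A} (m : M) :
    free Z ⟶ completeObj 𝒞 A (PreSum 𝒞 Z M) :=
  completeLift (E := PreFree 𝒞 A Z)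
    (toCompleteLin 𝒞 A (PreSum 𝒞 Z M) ∘ₗ
      (Finsupp.mapRange.linearMap (LinearMap.toSpanSingleton A M m) : (Z →₀ A) →ₗ[A] (Z →₀ M)))
    ⟨_, freeToSum_bound M.bddSMul.exists_bound.choose_spec m⟩

theorem freeToSum_coe {Z M : BanMod 𝒞 A} (m : M) (f : PreFree 𝒞 A Z) :
    Hom.lin (freeToSum Z m) (toComplete f) = toComplete (𝒞 := 𝒞) (E := PreSum 𝒞 Z M)
      (Finsupp.mapRange.linearMap (LinearMap.toSpanSingleton A M m) (f : Z →₀ A)) :=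
  completeLift_coe (E := PreFree 𝒞 A Z) _ _ f

theorem freeToSum_gen {Z M : BanMod 𝒞 A} (z : Z) (m : M) :
    Hom.lin (freeToSum Z m) (gen z) = toComplete (𝒞 := 𝒞) (E := PreSum 𝒞 Z M)
      (Finsupp.single z m : Z →₀ M) := by
  refine (freeToSum_coe m _).trans (congrArg _ ?_)
  refine (Finsupp.mapRange_single (hf := map_zero (LinearMap.toSpanSingleton A M m))).trans ?_
  rw [LinearMap.toSpanSingleton_apply, one_smul]

theorem free_induction {Z : BanMod 𝒞 A} {p : free Z → Prop} (hp : IsClosed {x | p x})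
    (h : ∀ f : PreFree 𝒞 A Z, p (toComplete f)) (x : free Z) : p x :=
  UniformSpace.Completion.induction_on (α := PreFree 𝒞 A Z) x hp h

/-- The comparison map `ℓ(Z, A) ⊗̂ M → ⨁̂_z M`. -/
noncomputable def tensorToSum (Z M : BanMod 𝒞 A) :
    tensor (free Z) M ⟶ completeObj 𝒞 A (PreSum 𝒞 Z M) :=
  tensorLift
    (LinearMap.mk₂ A (fun x m => Hom.lin (freeToSum Z m) x)
      (fun x y m => map_add _ x y) (fun a x m => map_smul _ a x)
      (fun x m m' => by
        refine free_induction (p := fun x => Hom.lin (freeToSum Z (m + m')) x =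
          Hom.lin (freeToSum Z m) x + Hom.lin (freeToSum Z m') x)
          (isClosed_eq (continuous_lin _) (Continuous.add (continuous_lin (freeToSum Z m))
            (continuous_lin (freeToSum Z m')))) (fun f => ?_) x
        rw [freeToSum_coe, freeToSum_coe, freeToSum_coe]
        refine Eq.trans (congrArg _ ?_) (map_add (toCompleteLin 𝒞 A (PreSum 𝒞 Z M)) _ _)
        exact Finsupp.ext fun z => smul_add (PreFree.toFinsupp f z) m m')
      (fun a x m => by
        refine free_induction (p := fun x => Hom.lin (freeToSum Z (a • m)) x =
          a • Hom.lin (freeToSum Z m) x)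
          (isClosed_eq (continuous_lin _) (Continuous.const_smul (continuous_lin (freeToSum Z m)) a))
          (fun f => ?_) x
        rw [freeToSum_coe, freeToSum_coe]
        refine Eq.trans (congrArg _ ?_) (map_smul (toCompleteLin 𝒞 A (PreSum 𝒞 Z M)) a _)
        exact Finsupp.ext fun z => smul_comm (PreFree.toFinsupp f z) a m)) <| by
    obtain ⟨C, hC⟩ := M.bddSMul.exists_bound
    refine ⟨C, fun x m => ?_⟩
    refine free_induction (p := fun x => ‖Hom.lin (freeToSum Z m) x‖ ≤ C * (‖x‖ * ‖m‖))
      (isClosed_le (continuous_lin _).norm (continuous_const.mul (continuous_norm.mul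
        continuous_const))) (fun f => ?_) x
    refine (congrArg norm (freeToSum_coe m f)).trans_le ((freeToSum_bound hC m f).trans_eq ?_)
    refine Eq.trans ?_ (congrArg (fun r => C * (r * ‖m‖))
      (norm_toComplete (𝒞 := 𝒞) (A := A) (E := PreFree 𝒞 A Z) f).symm)
    push_cast
    ring

theorem tensorToSum_genSum {Z M : BanMod 𝒞 A} (w : Z →₀ M) :
    Hom.lin (tensorToSum Z M) (genSum Z M w) = toComplete (𝒞 := 𝒞) (E := PreSum 𝒞 Z M) w := by
  induction w using Finsupp.induction_linear with
  | zero =>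
    rw [map_zero, map_zero]
    exact (map_zero (toCompleteLin 𝒞 A (PreSum 𝒞 Z M))).symm
  | add v w hv hw =>
    rw [map_add, map_add, hv, hw]
    exact (map_add (toCompleteLin 𝒞 A (PreSum 𝒞 Z M)) v w).symm
  | single z m =>
    rw [genSum_single]
    exact (tensorLift_tmul _ _ _ _).trans (freeToSum_gen z m)

theorem exists_norm_genSum_le (Z N : BanMod 𝒞 A) :
    ∃ D : ℝ≥0, ∀ {M : BanMod 𝒞 A} (v : Z →₀ M) (w : Z →₀ N) (C : ℝ≥0),
      (∀ z, ‖v z‖ ≤ C * ‖w z‖) → ‖genSum Z M v‖ ≤ D * C * ‖genSum Z N w‖ := by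
  obtain ⟨C', hC'⟩ := Hom.isBdd (tensorToSum Z N)
  refine ⟨‖(1 : A)‖₊ * C', fun v w C h => ?_⟩
  have h1 : (PreSum.seminorm (𝒞 := 𝒞) w : ℝ) ≤ C' * ‖genSum Z N w‖ := by
    refine le_trans (le_of_eq ?_) (hC' (genSum Z N w))
    exact ((congrArg norm (tensorToSum_genSum w)).trans
      (norm_toComplete (𝒞 := 𝒞) (A := A) (E := PreSum 𝒞 Z N) w)).symm
  have h2 : (PreSum.seminorm (𝒞 := 𝒞) v : ℝ) ≤ C * PreSum.seminorm (𝒞 := 𝒞) w :=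
    NNReal.coe_le_coe.2 (PreSum.seminorm_le_mul (v := v) (w := w) h)
  calc ‖genSum Z _ v‖ ≤ ‖(1 : A)‖₊ * PreSum.seminorm (𝒞 := 𝒞) v := norm_genSum_le v
    _ ≤ ‖(1 : A)‖₊ * (C * (C' * ‖genSum Z N w‖)) := by gcongr; exact h2.trans (by gcongr)
    _ = (‖(1 : A)‖₊ * C' : ℝ≥0) * C * ‖genSum Z N w‖ := by push_cast; ring

end BanMod

section Density

variable {𝒞 : Ambient} {A : Type u} [NormedCommRing A]

/-- A closed subgroup of `M ⊗̂ N` which contains the elementary tensors is everything. -/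
theorem BanMod.tensor_eq_top {M N : BanMod 𝒞 A} (H : AddSubgroup (BanMod.tensor M N))
    (hH : IsClosed (H : Set (BanMod.tensor M N))) (h : ∀ x y, BanMod.tmul x y ∈ H)
    (t : BanMod.tensor M N) : t ∈ H := by
  refine UniformSpace.Completion.induction_on (α := PreTensor 𝒞 A M N) (p := (· ∈ H)) t hH
    fun t => ?_
  induction t using TensorProduct.induction_on with
  | zero => exact H.zero_mem
  | tmul x y => exact h x y
  | add s t hs ht =>
    have h := H.add_mem hs ht
    exact (congrArg (· ∈ H)
      (map_add (toCompleteLin 𝒞 A (PreTensor 𝒞 A M N)) s t)).mpr h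

/-- The additive map `x ↦ x ⊗ y`. -/
noncomputable def BanMod.tmulHom (M : BanMod 𝒞 A) {N : BanMod 𝒞 A} (y : N) :
    M →+ BanMod.tensor M N :=
  AddMonoidHom.mk' (fun x => BanMod.tmul x y) fun x x' => BanMod.add_tmul x x' y

theorem BanMod.continuous_tmul_left {M N : BanMod 𝒞 A} (y : N) :
    Continuous fun x : M => BanMod.tmul x y :=
  AddMonoidHomClass.continuous_of_bound (BanMod.tmulHom M y) ‖y‖ fun x =>
    (BanMod.norm_tmul_le x y).trans_eq (mul_comm _ _)

theorem BanMod.smul_tmul {M N : BanMod 𝒞 A} (a : A) (x : M) (y : N) :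
    BanMod.tmul (a • x) y = BanMod.tmul x (a • y) :=
  congrArg (toComplete (𝒞 := 𝒞) (A := A) (E := PreTensor 𝒞 A M N)) (TensorProduct.smul_tmul a x y)

end Density

namespace BanMod

variable {𝒞 : Ambient} {A : Type u} [NormedCommRing A] [Ultra 𝒞 A]

theorem tmul_coe_mem_range_genSum {Z M : BanMod 𝒞 A} (f : Z →₀ A) (m : M) :
    tmulHom (free Z) m (toCompleteLin 𝒞 A (PreFree 𝒞 A Z) f) ∈ (genSum Z M).range := by
  let ψ : (Z →₀ A) →+ tensor (free Z) M := (tmulHom (free Z) m).comp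
    (AddMonoidHom.mk' (fun f => toCompleteLin 𝒞 A (PreFree 𝒞 A Z) f)
      (map_add (toCompleteLin 𝒞 A (PreFree 𝒞 A Z))))
  change ψ f ∈ _
  induction f using Finsupp.induction_linear with
  | zero =>
    rw [map_zero]
    exact zero_mem _
  | add f g hf hg =>
    rw [map_add]
    exact add_mem hf hg
  | single z a =>
    refine ⟨Finsupp.single z (a • m), (genSum_single _ _).trans ?_⟩
    refine (smul_tmul a (gen z) m).symm.trans (congrArg (tmul · m) ?_)
    refine (map_smul (toCompleteLin 𝒞 A (PreFree 𝒞 A Z)) a _).symm.trans (congrArg _ ?_)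
    exact (Finsupp.smul_single a z (1 : A)).trans (by rw [smul_eq_mul, mul_one])

theorem dense_range_genSum (Z M : BanMod 𝒞 A) : Dense (Set.range (genSum Z M)) := by
  intro t
  refine tensor_eq_top (genSum Z M).range.topologicalClosure
    (AddSubgroup.isClosed_topologicalClosure _) (fun x m => ?_) t
  refine free_induction (p := fun x => tmul x m ∈ (genSum Z M).range.topologicalClosure)
    ((AddSubgroup.isClosed_topologicalClosure _).preimage (continuous_tmul_left m)) (fun f => ?_) x
  exact AddSubgroup.le_topologicalClosure _ (tmul_coe_mem_range_genSum f m)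

/-- The functor `ℓ(Z, A) ⊗̂ -` preserves strict exactness. -/
theorem RelExact.approxExact_free_tensor {M N P : BanMod 𝒞 A} {f : M ⟶ N} {g : N ⟶ P}
    (h : RelExact f g) (Z : BanMod 𝒞 A) :
    ApproxExact (tensorMap (𝟙 (free Z)) f) (tensorMap (𝟙 (free Z)) g) := by
  obtain ⟨h0, C, hC⟩ := h
  obtain ⟨D, hD⟩ := exists_norm_genSum_le Z N
  obtain ⟨E, hE⟩ := exists_norm_genSum_le Z P
  choose s hs1 hs2 using hC
  have hs0 : s 0 = 0 := by simpa using hs1 0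
  refine ApproxExact.of_dense ?_ (dense_range_genSum Z N) (max D E * C) ?_
  · rw [tensorMap_comp, h0, tensorMap_zero]
  rintro _ ⟨w, rfl⟩ ε hε
  have hDE : (D : ℝ) ≤ max D E ∧ (E : ℝ) ≤ max D E := by simp
  refine ⟨genSum Z M (Finsupp.mapRange s hs0 w), ?_, ?_⟩
  · have h1 := hD (Finsupp.mapRange s hs0 w) w C fun z => by
      rw [Finsupp.mapRange_apply]
      exact hs1 (w z)
    refine h1.trans (le_add_of_le_of_nonneg ?_ hε.le)
    push_cast at hDE ⊢
    gcongr
    exact hDE.1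
  · rw [← genSum_mapRange, ← genSum_mapRange, ← map_sub]
    have h1 := hE (w - Finsupp.mapRange (Hom.lin f) (map_zero _) (Finsupp.mapRange s hs0 w))
      (Finsupp.mapRange (Hom.lin g) (map_zero _) w) C fun z => by
        rw [Finsupp.sub_apply, Finsupp.mapRange_apply, Finsupp.mapRange_apply,
          Finsupp.mapRange_apply]
        exact hs2 (w z)
    refine h1.trans (le_add_of_le_of_nonneg ?_ hε.le)
    push_cast at hDE ⊢
    gcongr
    exact hDE.2

/-- The functor `ℓ(Z, A) ⊗̂ -` preserves surjections with bounded sections. -/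
theorem approxExact_free_tensor_zero {M N P : BanMod 𝒞 A} {f : M ⟶ N} (C : ℝ≥0)
    (h : ∀ y, ∃ x, Hom.lin f x = y ∧ ‖x‖ ≤ C * ‖y‖) (Z : BanMod 𝒞 A) :
    ApproxExact (tensorMap (𝟙 (free Z)) f) (0 : _ ⟶ P) := by
  have h' : RelExact f (0 : N ⟶ P) := by
    refine ⟨comp_zero, C, fun y => ?_⟩
    obtain ⟨x, rfl, hx⟩ := h y
    exact ⟨x, hx, by simp⟩
  obtain ⟨-, D, hD⟩ := h'.approxExact_free_tensor Z
  refine ⟨comp_zero, D, fun y ε hε => ?_⟩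
  obtain ⟨x, hx, hx'⟩ := hD y ε hε
  refine ⟨x, hx, ?_⟩
  rw [tensorMap_zero] at hx'
  simpa using hx'

end BanMod

end BanachGeometry

namespace BanachGeometry

namespace BanMod

variable {𝒞 : Ambient} {A : Type u} [NormedCommRing A]

/-! ## Cyclic modules whose annihilator has a bounded approximate identity -/

/-- The Banach module `N` is generated by `e` with bounded coefficients, and the annihilator of `e`
has a bounded approximate identity, namely `1 - u` for the elements `u` below. -/
structure IsFlatGenerator (N : BanMod 𝒞 A) (e : N) : Prop where
  exists_smul_eq : ∃ C : ℝ≥0, ∀ y : N, ∃ a : A, a • e = y ∧ ‖a‖ ≤ C * ‖y‖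
  exists_mul_le : ∃ D : ℝ≥0, ∀ s : Finset A, (∀ i ∈ s, i • e = 0) → ∀ δ : ℝ, 0 < δ →
    ∃ u : A, u • e = e ∧ ‖u‖ ≤ D ∧ ∀ i ∈ s, ‖u * i‖ ≤ δ

namespace IsFlatGenerator

variable {N : BanMod 𝒞 A} {e : N}

theorem exists_tmul_eq (h : IsFlatGenerator N e) (M : BanMod 𝒞 A) :
    ∃ C : ℝ≥0, ∀ (t : PreTensor 𝒞 A M N) (ε : ℝ), 0 < ε →
      ∃ m : M, (m ⊗ₜ[A] e : M ⊗[A] N) = t ∧ ‖m‖ ≤ C * (‖t‖ + ε) := by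
  obtain ⟨C, hC⟩ := h.exists_smul_eq
  obtain ⟨D, hD⟩ := M.bddSMul.exists_bound
  refine ⟨D * C, fun t ε hε => ?_⟩
  obtain ⟨r, ⟨n, m, k, rfl, rfl⟩, hr⟩ :=
    PreTensor.exists_size_lt t (e := ⟨ε, hε.le⟩) (by exact_mod_cast hε)
  choose a ha1 ha2 using hC
  refine ⟨∑ i, a (k i) • m i, ?_, ?_⟩
  · rw [TensorProduct.sum_tmul]
    refine Finset.sum_congr rfl fun i _ => ?_
    rw [TensorProduct.smul_tmul, ha1]
  · have h1 : ‖∑ i, a (k i) • m i‖₊ ≤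
        D * C * agg 𝒞 Finset.univ (fun i => ‖m i‖₊ * ‖k i‖₊) := by
      refine (nnnorm_sum_le_agg (𝒞 := 𝒞) _ _).trans (agg_le_mul _ _ _ _ fun i _ => ?_)
      have h2 : ‖a (k i) • m i‖₊ ≤ D * ‖a (k i)‖₊ * ‖m i‖₊ := hD _ _
      have h3 : ‖a (k i)‖₊ ≤ C * ‖k i‖₊ := ha2 _
      calc _ ≤ D * (C * ‖k i‖₊) * ‖m i‖₊ := h2.trans (by gcongr)
        _ = _ := by ring
    have h4 : ‖∑ i, a (k i) • m i‖₊ ≤ D * C * (PreTensor.seminorm (𝒞 := 𝒞)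
        (∑ i, (m i ⊗ₜ[A] k i : M ⊗[A] N)) + ⟨ε, hε.le⟩) :=
      h1.trans (mul_le_mul_right hr.le _)
    exact h4

theorem exists_smul_le_of_tmul_eq_zero (h : IsFlatGenerator N e) {M : BanMod 𝒞 A} (x : M)
    (hx : (x ⊗ₜ[A] e : M ⊗[A] N) = 0) :
    ∃ (s : Finset A) (c : ℝ≥0), (∀ i ∈ s, i • e = 0) ∧
      ∀ (u : A) (δ : ℝ), 0 ≤ δ → (∀ i ∈ s, ‖u * i‖ ≤ δ) → ‖u • x‖ ≤ c * δ := by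
  classical
  obtain ⟨C, hC⟩ := h.exists_smul_eq
  obtain ⟨D, hD⟩ := M.bddSMul.exists_bound
  let q : A →ₗ[A] N := LinearMap.toSpanSingleton A N e
  have hq : Function.Surjective q := fun y => by
    obtain ⟨a, ha, -⟩ := hC y
    exact ⟨a, ha⟩
  have hex : Function.Exact (LinearMap.ker q).subtype q := LinearMap.exact_subtype_ker_map q
  have h1 : q.lTensor M (x ⊗ₜ[A] (1 : A)) = 0 := by
    rw [LinearMap.lTensor_tmul, LinearMap.toSpanSingleton_apply, one_smul, hx]
  obtain ⟨t, ht⟩ := (lTensor_exact M hex hq _).1 h1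
  have hx' : x = TensorProduct.rid A M ((LinearMap.ker q).subtype.lTensor M t) := by
    rw [ht, TensorProduct.rid_tmul, one_smul]
  rw [hx']
  clear hx' ht
  induction t using TensorProduct.induction_on with
  | zero => exact ⟨∅, 0, by simp, by simp⟩
  | tmul m i =>
    refine ⟨{i.1}, D * ‖m‖₊, fun j hj => ?_, fun u δ hδ hu => ?_⟩
    · rw [Finset.mem_singleton.1 hj]
      exact i.2
    · rw [LinearMap.lTensor_tmul, TensorProduct.rid_tmul, Submodule.subtype_apply, smul_smul]
      refine (hD _ _).trans ?_
      have := hu i.1 (Finset.mem_singleton_self _)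
      calc (D : ℝ) * ‖u * i.1‖ * ‖m‖ ≤ D * δ * ‖m‖ := by gcongr
        _ = (D * ‖m‖₊ : ℝ≥0) * δ := by push_cast; ring
  | add t t' ht ht' =>
    obtain ⟨s, c, hs, hc⟩ := ht
    obtain ⟨s', c', hs', hc'⟩ := ht'
    refine ⟨s ∪ s', c + c', fun i hi => ?_, fun u δ hδ hu => ?_⟩
    · obtain hi | hi := Finset.mem_union.1 hi
      exacts [hs i hi, hs' i hi]
    · rw [map_add, map_add, smul_add]
      refine (norm_add_le _ _).trans ?_
      rw [NNReal.coe_add, add_mul]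
      exact add_le_add (hc u δ hδ fun i hi => hu i (Finset.mem_union_left _ hi))
        (hc' u δ hδ fun i hi => hu i (Finset.mem_union_right _ hi))

theorem exists_smul_le (h : IsFlatGenerator N e) (M : BanMod 𝒞 A) :
    ∃ C D : ℝ≥0, ∀ (m : M) (ε : ℝ), 0 < ε →
      ∃ u : A, u • e = e ∧ ‖u‖ ≤ D ∧ ‖u • m‖ ≤ C * ‖tmul m e‖ + ε := by
  obtain ⟨C, hC⟩ := h.exists_tmul_eq M
  obtain ⟨E, hE⟩ := M.bddSMul.exists_bound
  obtain ⟨D, hD⟩ := h.exists_mul_le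
  refine ⟨E * D * C, D, fun m ε hε => ?_⟩
  obtain ⟨m', hm', hm⟩ := hC (m ⊗ₜ[A] e : M ⊗[A] N) (ε / 2 / (E * D * C + 1)) (by positivity)
  obtain ⟨s, c, hs, hc⟩ := h.exists_smul_le_of_tmul_eq_zero (m - m') (by
    rw [TensorProduct.sub_tmul, hm', sub_self])
  obtain ⟨u, hu1, hu2, hu3⟩ := hD s hs (ε / 2 / (c + 1)) (by positivity)
  refine ⟨u, hu1, hu2, ?_⟩
  have h1 : ‖u • m‖ ≤ ‖u • m'‖ + ‖u • (m - m')‖ := by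
    rw [show u • m = u • m' + u • (m - m') by rw [← smul_add, add_sub_cancel]]
    exact norm_add_le _ _
  have h2 : ‖u • (m - m')‖ ≤ ε / 2 := by
    refine (hc u _ (by positivity) hu3).trans ?_
    rw [mul_div_assoc', div_le_iff₀ (by positivity)]
    nlinarith [c.2]
  have hn : ‖(show PreTensor 𝒞 A M N from m ⊗ₜ[A] e)‖ = ‖tmul m e‖ :=
    (norm_toComplete (𝒞 := 𝒞) (A := A) (E := PreTensor 𝒞 A M N) _).symm
  have h3 : ‖u • m'‖ ≤ E * D * C * ‖tmul m e‖ + ε / 2 := by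
    have h4 : ‖m'‖ ≤ C * (‖tmul m e‖ + ε / 2 / (E * D * C + 1)) := hn ▸ hm
    calc ‖u • m'‖ ≤ E * ‖u‖ * ‖m'‖ := hE _ _
      _ ≤ E * D * (C * (‖tmul m e‖ + ε / 2 / (E * D * C + 1))) := by gcongr
      _ = E * D * C * ‖tmul m e‖ + E * D * C * (ε / 2 / (E * D * C + 1)) := by ring
      _ ≤ E * D * C * ‖tmul m e‖ + ε / 2 := by
        gcongr
        rw [mul_div_assoc', div_le_iff₀ (by positivity)]
        nlinarith
  push_cast
  linarith

theorem dense_range_toComplete (M N : BanMod 𝒞 A) :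
    Dense (Set.range (toComplete (𝒞 := 𝒞) (A := A) (E := PreTensor 𝒞 A M N)) : Set (tensor M N)) :=
  UniformSpace.Completion.denseRange_coe (α := PreTensor 𝒞 A M N)

/-- Every element of a dense subset of `M ⊗̂ N` is of the form `m ⊗ e` with a bound on `m`. -/
theorem exists_dense (h : IsFlatGenerator N e) (M : BanMod 𝒞 A) :
    ∃ (s : Set (tensor M N)) (C : ℝ≥0), Dense s ∧ ∀ y ∈ s, ∀ ε : ℝ, 0 < ε →
      ∃ m : M, tmul m e = y ∧ ‖m‖ ≤ C * ‖y‖ + ε := by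
  obtain ⟨C, hC⟩ := h.exists_tmul_eq M
  refine ⟨_, C, dense_range_toComplete M N, ?_⟩
  rintro _ ⟨t, rfl⟩ ε hε
  obtain ⟨m, hm, hm'⟩ := hC t (ε / (C + 1)) (by positivity)
  refine ⟨m, congrArg (toComplete (𝒞 := 𝒞) (A := A) (E := PreTensor 𝒞 A M N)) hm, hm'.trans ?_⟩
  have hn : ‖(toComplete t : tensor M N)‖ = ‖t‖ :=
    norm_toComplete (𝒞 := 𝒞) (A := A) (E := PreTensor 𝒞 A M N) t
  refine le_of_le_of_eq ?_ (congrArg (fun r => C * r + ε) hn.symm)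
  rw [mul_add]
  gcongr
  rw [mul_div_assoc', div_le_iff₀ (by positivity)]
  nlinarith [C.2]

/-- The functor `- ⊗̂ N` preserves strict exactness. -/
theorem approxExact_tensor (h : IsFlatGenerator N e) {M P Q : BanMod 𝒞 A} {f : M ⟶ P} {g : P ⟶ Q}
    (hfg : RelExact f g) : ApproxExact (tensorMap f (𝟙 N)) (tensorMap g (𝟙 N)) := by
  obtain ⟨h0, C, hC⟩ := hfg
  obtain ⟨s, C₁, hs, hC₁⟩ := h.exists_dense P
  obtain ⟨C₂, D, hC₂⟩ := h.exists_smul_le Q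
  obtain ⟨E, hE⟩ := P.bddSMul.exists_bound
  set k : ℝ≥0 := ‖e‖₊ * C with hk
  refine ApproxExact.of_dense ?_ hs (k * E * D * C₁ + k * C₂) fun y hy ε hε => ?_
  · rw [tensorMap_comp, h0, zero_tensorMap]
  obtain ⟨p, rfl, hp⟩ := hC₁ y hy (ε / (k * E * D + 1)) (by positivity)
  obtain ⟨u, hu1, hu2, hu3⟩ := hC₂ (Hom.lin g p) (ε / (k + 1)) (by positivity)
  obtain ⟨x, hx1, hx2⟩ := hC (u • p)
  refine ⟨tmul x e, (norm_tmul_le x e).trans ?_, ?_⟩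
  · calc ‖x‖ * ‖e‖ ≤ C * (E * D * (C₁ * ‖tmul p e‖ + ε / (k * E * D + 1))) * ‖e‖ := by
          gcongr
          refine hx1.trans ?_
          gcongr
          exact (hE _ _).trans (by gcongr)
      _ = k * E * D * C₁ * ‖tmul p e‖ + k * E * D * (ε / (k * E * D + 1)) := by
          rw [hk]; push_cast; ring
      _ ≤ (k * E * D * C₁ + k * C₂) * ‖tmul p e‖ + ε := by
          have h1 : (k : ℝ) * E * D * (ε / (k * E * D + 1)) ≤ ε := by
            rw [mul_div_assoc', div_le_iff₀ (by positivity)]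
            nlinarith
          have h2 : (0 : ℝ) ≤ k * C₂ * ‖tmul p e‖ := by positivity
          linarith
      _ = _ := by push_cast; ring
  · have h1 : tmul p e - Hom.lin (tensorMap f (𝟙 N)) (tmul x e) =
        tmul (u • p - Hom.lin f x) e := by
      rw [tensorMap_tmul, lin_id]
      have h2 : tmul p e = tmul (u • p) e := by rw [smul_tmul, hu1]
      rw [h2]
      exact (map_sub (tmulHom P e) _ _).symm
    rw [h1]
    have h3 : ‖Hom.lin g (u • p)‖ ≤ C₂ * ‖Hom.lin (tensorMap g (𝟙 N)) (tmul p e)‖ + ε / (k + 1) := by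
      rw [map_smul, tensorMap_tmul, lin_id]
      exact hu3
    set r : ℝ := ‖Hom.lin (tensorMap g (𝟙 N)) (tmul p e)‖ with hr
    have hr0 : 0 ≤ r := norm_nonneg _
    calc ‖tmul (u • p - Hom.lin f x) e‖ ≤ ‖u • p - Hom.lin f x‖ * ‖e‖ := norm_tmul_le _ _
      _ ≤ C * (C₂ * r + ε / (k + 1)) * ‖e‖ := by
        gcongr
        exact hx2.trans (by gcongr)
      _ = k * C₂ * r + k * (ε / (k + 1)) := by rw [hk]; push_cast; ring
      _ ≤ (k * E * D * C₁ + k * C₂) * r + ε := by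
          have h1 : (k : ℝ) * (ε / (k + 1)) ≤ ε := by
            rw [mul_div_assoc', div_le_iff₀ (by positivity)]
            nlinarith
          have h2 : (0 : ℝ) ≤ k * E * D * C₁ * r := by positivity
          linarith
      _ = _ := by push_cast; ring

/-- The end of a resolution tensored with `N`. -/
theorem approxExact_tensor_of_tmul (h : IsFlatGenerator N e) {M P Q : BanMod 𝒞 A} {f : M ⟶ P}
    {g : P ⟶ Q} (hfg : RelExact f g) (μ : tensor P N ⟶ Q)
    (hμ : ∀ p, Hom.lin μ (tmul p e) = Hom.lin g p) : ApproxExact (tensorMap f (𝟙 N)) μ := by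
  obtain ⟨h0, C, hC⟩ := hfg
  obtain ⟨s, C₁, hs, hC₁⟩ := h.exists_dense P
  set k : ℝ≥0 := ‖e‖₊ * C with hk
  refine ApproxExact.of_dense ?_ hs (k * C₁ + k) fun y hy ε hε => ?_
  · refine tensor_hom_ext fun x y => ?_
    obtain ⟨E, hE⟩ := h.exists_smul_eq
    obtain ⟨a, rfl, -⟩ := hE y
    rw [lin_comp, tensorMap_tmul, lin_id, ← smul_tmul, hμ, ← map_smul, lin_lin_eq_zero h0, lin_zero]
  obtain ⟨p, rfl, hp⟩ := hC₁ y hy (ε / (k + 1)) (by positivity)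
  obtain ⟨x, hx1, hx2⟩ := hC p
  refine ⟨tmul x e, (norm_tmul_le x e).trans ?_, ?_⟩
  · calc ‖x‖ * ‖e‖ ≤ C * (C₁ * ‖tmul p e‖ + ε / (k + 1)) * ‖e‖ := by
          gcongr
          exact hx1.trans (by gcongr)
      _ = k * C₁ * ‖tmul p e‖ + k * (ε / (k + 1)) := by rw [hk]; push_cast; ring
      _ ≤ (k * C₁ + k) * ‖tmul p e‖ + ε := by
          have h1 : (k : ℝ) * (ε / (k + 1)) ≤ ε := by
            rw [mul_div_assoc', div_le_iff₀ (by positivity)]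
            nlinarith
          have h2 : (0 : ℝ) ≤ k * ‖tmul p e‖ := by positivity
          linarith
      _ = _ := by push_cast; ring
  · have h1 : tmul p e - Hom.lin (tensorMap f (𝟙 N)) (tmul x e) = tmul (p - Hom.lin f x) e := by
      rw [tensorMap_tmul, lin_id]
      exact (map_sub (tmulHom P e) _ _).symm
    rw [h1, hμ]
    calc ‖tmul (p - Hom.lin f x) e‖ ≤ ‖p - Hom.lin f x‖ * ‖e‖ := norm_tmul_le _ _
      _ ≤ C * ‖Hom.lin g p‖ * ‖e‖ := by gcongr
      _ = k * ‖Hom.lin g p‖ := by rw [hk]; push_cast; ring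
      _ ≤ (k * C₁ + k) * ‖Hom.lin g p‖ + ε := by
          have h2 : (0 : ℝ) ≤ k * C₁ * ‖Hom.lin g p‖ := by positivity
          linarith
      _ = _ := by push_cast; ring

end IsFlatGenerator

end BanMod

end BanachGeometry

namespace BanachGeometry

open BanMod

variable {𝒞 : Ambient} {A : Type u} [NormedCommRing A]

namespace BanMod

theorem lin_neg {M N : BanMod 𝒞 A} (f : M ⟶ N) (x : M) : Hom.lin (-f) x = -Hom.lin f x := rfl

theorem lin_units_smul {M N : BanMod 𝒞 A} (ε : ℤˣ) (f : M ⟶ N) (x : M) :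
    Hom.lin (ε • f) x = ε • Hom.lin f x := by
  obtain rfl | rfl := Int.units_eq_one_or ε
  · rw [one_smul, one_smul]
  · rw [Units.neg_smul, Units.neg_smul, one_smul, one_smul, lin_neg]

theorem map_units_smul {M N : BanMod 𝒞 A} (f : M ⟶ N) (ε : ℤˣ) (x : M) :
    Hom.lin f (ε • x) = ε • Hom.lin f x := by
  obtain rfl | rfl := Int.units_eq_one_or ε
  · rw [one_smul, one_smul]
  · rw [Units.neg_smul, Units.neg_smul, one_smul, one_smul, map_neg]

theorem lin_sum {ι : Type*} {M N : BanMod 𝒞 A} (s : Finset ι) (f : ι → (M ⟶ N)) (x : M) :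
    Hom.lin (∑ i ∈ s, f i) x = ∑ i ∈ s, Hom.lin (f i) x :=
  map_sum (AddMonoidHom.mk' (fun g : M ⟶ N => Hom.lin g x) fun g g' => lin_add g g' x) f s

theorem norm_units_smul {E : Type*} [SeminormedAddCommGroup E] (ε : ℤˣ) (x : E) : ‖ε • x‖ = ‖x‖ := by
  obtain rfl | rfl := Int.units_eq_one_or ε
  · rw [one_smul]
  · rw [Units.neg_smul, one_smul, norm_neg]

end BanMod

/-! ## The total complex of a tensor product of two complexes -/

section Total

variable (K L : ChainComplex (BanMod 𝒞 A) ℕ)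

/-- The total complex `Tot (K ⊗̂ L)`. -/
noncomputable abbrev tot : ChainComplex (BanMod 𝒞 A) ℕ :=
  HomologicalComplex.mapBifunctor K L (BanMod.tensorFunctor 𝒞 A) (ComplexShape.down ℕ)

/-- The inclusion of a summand of the total complex. -/
noncomputable def totι (i j n : ℕ) (h : i + j = n) : tensor (K.X i) (L.X j) ⟶ (tot K L).X n :=
  HomologicalComplex.ιMapBifunctor K L (tensorFunctor 𝒞 A) (ComplexShape.down ℕ) i j n h

/-- The projection to a summand of the total complex. -/
noncomputable def totπ (i j n : ℕ) (h : i + j = n) : (tot K L).X n ⟶ tensor (K.X i) (L.X j) :=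
  HomologicalComplex.mapBifunctorDesc fun i' j' h' =>
    if hi : i' = i then eqToHom (by
      have h' : i' + j' = n := h'
      obtain rfl := hi
      obtain rfl : j' = j := by omega
      rfl) else 0

variable {K L}

theorem tot_hom_ext {n : ℕ} {M : BanMod 𝒞 A} {f g : (tot K L).X n ⟶ M}
    (h : ∀ i j h, totι K L i j n h ≫ f = totι K L i j n h ≫ g) : f = g :=
  HomologicalComplex.mapBifunctor.hom_ext h

theorem totι_totπ (i j n : ℕ) (h : i + j = n) : totι K L i j n h ≫ totπ K L i j n h = 𝟙 _ := by
  refine (HomologicalComplex.ι_mapBifunctorDesc _ i j h).trans ?_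
  rw [dif_pos rfl]
  rfl

theorem totι_totπ_of_ne {i j i' j' n : ℕ} (h : i + j = n) (h' : i' + j' = n) (hi : i ≠ i') :
    totι K L i j n h ≫ totπ K L i' j' n h' = 0 := by
  refine (HomologicalComplex.ι_mapBifunctorDesc _ i j h).trans ?_
  exact dif_neg hi

theorem sum_totπ_totι (n : ℕ) :
    ∑ i : Fin (n + 1), totπ K L i (n - i) n (by omega) ≫ totι K L i (n - i) n (by omega) = 𝟙 _ := by
  refine tot_hom_ext fun i j h => ?_
  rw [Preadditive.comp_sum, Finset.sum_eq_single (⟨i, by omega⟩ : Fin (n + 1))]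
  · obtain rfl : j = n - i := by omega
    rw [← Category.assoc, totι_totπ, Category.id_comp, Category.comp_id]
  · rintro ⟨i', hi'⟩ - hne
    rw [← Category.assoc, totι_totπ_of_ne, zero_comp]
    rintro rfl
    exact hne rfl
  · simp

theorem eq_zero_of_totπ {n : ℕ} (y : (tot K L).X n)
    (h : ∀ i j h, Hom.lin (totπ K L i j n h) y = 0) : y = 0 := by
  rw [← lin_id _ y, ← sum_totπ_totι, lin_sum]
  refine Finset.sum_eq_zero fun i _ => ?_
  rw [lin_comp, h, map_zero]

/-- The sign of the second differential. -/
def totSign (i : ℕ) : ℤˣ := (ComplexShape.down ℕ).ε i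

theorem totι_d_totπ {i j n : ℕ} (h : i + j = n) {i' j' : ℕ} (h' : i' + j' = n + 1) :
    totι K L i' j' (n + 1) h' ≫ (tot K L).d (n + 1) n ≫ totπ K L i j n h =
      totι K L i' j' (n + 1) h' ≫ (totπ K L (i + 1) j (n + 1) (by omega) ≫
        tensorMap (K.d (i + 1) i) (𝟙 _) +
      totSign i • (totπ K L i (j + 1) (n + 1) (by omega) ≫ tensorMap (𝟙 _) (L.d (j + 1) j))) := by
  obtain ⟨a, ha⟩ : ∃ a : tensor (K.X i') (L.X j') ⟶ (tot K L).X n, a =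
    HomologicalComplex.mapBifunctor.d₁ K L (tensorFunctor 𝒞 A) (ComplexShape.down ℕ) i' j' n :=
    ⟨_, rfl⟩
  obtain ⟨b, hb⟩ : ∃ b : tensor (K.X i') (L.X j') ⟶ (tot K L).X n, b =
    HomologicalComplex.mapBifunctor.d₂ K L (tensorFunctor 𝒞 A) (ComplexShape.down ℕ) i' j' n :=
    ⟨_, rfl⟩
  have hab : totι K L i' j' (n + 1) h' ≫ (tot K L).d (n + 1) n = a + b := by
    rw [ha, hb]
    change HomologicalComplex.ιMapBifunctor _ _ _ _ i' j' (n + 1) h' ≫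
      (HomologicalComplex.mapBifunctor.D₁ _ _ _ _ (n + 1) n +
        HomologicalComplex.mapBifunctor.D₂ _ _ _ _ (n + 1) n) = _
    rw [Preadditive.comp_add, HomologicalComplex.mapBifunctor.ι_D₁,
      HomologicalComplex.mapBifunctor.ι_D₂]
    rfl
  rw [← Category.assoc, hab, Preadditive.add_comp, Preadditive.comp_add, Linear.comp_units_smul]
  congr 1
  · cases i' with
    | zero =>
      have h1 : a = 0 :=
        ha.trans (HomologicalComplex.mapBifunctor.d₁_eq_zero _ _ _ _ 0 j' n (by simp))
      rw [h1, zero_comp, ← Category.assoc, totι_totπ_of_ne _ _ (by omega), zero_comp]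
    | succ i' =>
      have h1 : a = tensorMap (K.d (i' + 1) i') (𝟙 _) ≫ totι K L i' j' n (by omega) :=
        ha.trans ((HomologicalComplex.mapBifunctor.d₁_eq _ _ _ _ (i₁ := i' + 1) (i₁' := i')
          (by simp) j' n (show i' + j' = n by omega)).trans (one_smul ℤˣ _))
      rw [h1]
      obtain rfl | hne := eq_or_ne i' i
      · obtain rfl : j' = j := by omega
        rw [Category.assoc, totι_totπ, Category.comp_id, ← Category.assoc, totι_totπ,
          Category.id_comp]
      · rw [Category.assoc, totι_totπ_of_ne _ _ hne, comp_zero, ← Category.assoc,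
          totι_totπ_of_ne _ _ (by omega), zero_comp]
  · cases j' with
    | zero =>
      have h1 : b = 0 :=
        hb.trans (HomologicalComplex.mapBifunctor.d₂_eq_zero _ _ _ _ i' 0 n (by simp))
      rw [h1, zero_comp, ← Category.assoc, totι_totπ_of_ne _ _ (by omega), zero_comp, smul_zero]
    | succ j' =>
      have h1 : b = totSign i' • (tensorMap (𝟙 _) (L.d (j' + 1) j') ≫
          totι K L i' j' n (by omega)) :=
        hb.trans (HomologicalComplex.mapBifunctor.d₂_eq _ _ _ _ i' (i₂ := j' + 1) (i₂' := j')
          (by simp) n (show i' + j' = n by omega))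
      rw [h1, Linear.units_smul_comp]
      obtain rfl | hne := eq_or_ne i' i
      · obtain rfl : j' = j := by omega
        rw [Category.assoc, totι_totπ, Category.comp_id, ← Category.assoc, totι_totπ,
          Category.id_comp]
      · rw [Category.assoc, totι_totπ_of_ne _ _ hne, comp_zero, ← Category.assoc,
          totι_totπ_of_ne _ _ (by omega), zero_comp, smul_zero, smul_zero]

theorem tot_d_totπ {i j n : ℕ} (h : i + j = n) :
    (tot K L).d (n + 1) n ≫ totπ K L i j n h =
      totπ K L (i + 1) j (n + 1) (by omega) ≫ tensorMap (K.d (i + 1) i) (𝟙 _) +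
      totSign i • (totπ K L i (j + 1) (n + 1) (by omega) ≫ tensorMap (𝟙 _) (L.d (j + 1) j)) :=
  tot_hom_ext fun _ _ h' => totι_d_totπ h h'

/-- The cycles of the total complex, in terms of components. -/
def IsTotCycle {n : ℕ} (y : (tot K L).X n) : Prop :=
  ∀ i j (h : i + j + 1 = n),
    Hom.lin (tensorMap (K.d (i + 1) i) (𝟙 _)) (Hom.lin (totπ K L (i + 1) j n (by omega)) y) +
      totSign i • Hom.lin (tensorMap (𝟙 _) (L.d (j + 1) j))
        (Hom.lin (totπ K L i (j + 1) n (by omega)) y) = 0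

theorem lin_totπ_d {i j n : ℕ} (h : i + j = n) (y : (tot K L).X (n + 1)) :
    Hom.lin (totπ K L i j n h) (Hom.lin ((tot K L).d (n + 1) n) y) =
      Hom.lin (tensorMap (K.d (i + 1) i) (𝟙 _))
        (Hom.lin (totπ K L (i + 1) j (n + 1) (by omega)) y) +
      totSign i • Hom.lin (tensorMap (𝟙 _) (L.d (j + 1) j))
        (Hom.lin (totπ K L i (j + 1) (n + 1) (by omega)) y) := by
  rw [← lin_comp, tot_d_totπ, lin_add, lin_comp, lin_units_smul, lin_comp]

theorem isTotCycle_of_d_eq_zero {n : ℕ} (y : (tot K L).X (n + 1))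
    (hy : Hom.lin ((tot K L).d (n + 1) n) y = 0) : IsTotCycle y := by
  intro i j h
  obtain rfl : i + j = n := by omega
  rw [← lin_totπ_d rfl, hy, map_zero]

theorem isTotCycle_d {n : ℕ} (y : (tot K L).X (n + 1)) :
    IsTotCycle (Hom.lin ((tot K L).d (n + 1) n) y) := by
  cases n with
  | zero => exact fun i j h => absurd h (by omega)
  | succ n => exact isTotCycle_of_d_eq_zero _ (lin_lin_eq_zero ((tot K L).d_comp_d _ _ _) y)

theorem IsTotCycle.sub {n : ℕ} {y z : (tot K L).X n} (hy : IsTotCycle y) (hz : IsTotCycle z) :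
    IsTotCycle (y - z) := by
  intro i j h
  simp only [map_sub, smul_sub]
  rw [sub_add_sub_comm, hy i j h, hz i j h, sub_zero]

theorem lin_totπ_totι (i j n : ℕ) (h : i + j = n) (x : tensor (K.X i) (L.X j)) :
    Hom.lin (totπ K L i j n h) (Hom.lin (totι K L i j n h) x) = x := by
  rw [← lin_comp, totι_totπ, lin_id]

theorem lin_totπ_totι_of_ne {i j i' j' n : ℕ} (h : i + j = n) (h' : i' + j' = n) (hi : i ≠ i')
    (x : tensor (K.X i) (L.X j)) :
    Hom.lin (totπ K L i' j' n h') (Hom.lin (totι K L i j n h) x) = 0 := by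
  rw [← lin_comp, totι_totπ_of_ne h h' hi, lin_zero]

variable {N : BanMod 𝒞 A} {η : L.X 0 ⟶ N}

/-- The condition that the columns of the double complex are exact resolutions. -/
structure ColumnsExact (K L : ChainComplex (BanMod 𝒞 A) ℕ) {N : BanMod 𝒞 A} (η : L.X 0 ⟶ N) :
    Prop where
  succ : ∀ i j, BddExact (tensorMap (𝟙 (K.X i)) (L.d (j + 2) (j + 1)))
    (tensorMap (𝟙 (K.X i)) (L.d (j + 1) j))
  zero : ∀ i, BddExact (tensorMap (𝟙 (K.X i)) (L.d 1 0)) (tensorMap (𝟙 (K.X i)) η)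
  surj : ∀ i, ∃ C : ℝ≥0, ∀ y, ∃ x, Hom.lin (tensorMap (𝟙 (K.X i)) η) x = y ∧ ‖x‖ ≤ C * ‖y‖

theorem ColumnsExact.exists_column_preimage (hc : ColumnsExact K L η) (n k j : ℕ)
    (hkj : k + j = n) : ∃ C : ℝ≥0, ∀ y : (tot K L).X n, IsTotCycle y →
      (∀ i j h, k + 1 ≤ i → Hom.lin (totπ K L i j n h) y = 0) →
      Hom.lin (tensorMap (𝟙 (K.X n)) η) (Hom.lin (totπ K L n 0 n rfl) y) = 0 →
      ∃ x, Hom.lin (tensorMap (𝟙 (K.X k)) (L.d (j + 1) j)) x = Hom.lin (totπ K L k j n hkj) y ∧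
        ‖x‖ ≤ C * ‖y‖ := by
  obtain ⟨P, hP⟩ := Hom.isBdd (totπ K L k j n hkj)
  suffices H : ∃ C : ℝ≥0, ∀ y : (tot K L).X n, IsTotCycle y →
      (∀ i j h, k + 1 ≤ i → Hom.lin (totπ K L i j n h) y = 0) →
      Hom.lin (tensorMap (𝟙 (K.X n)) η) (Hom.lin (totπ K L n 0 n rfl) y) = 0 →
      ∃ x, Hom.lin (tensorMap (𝟙 (K.X k)) (L.d (j + 1) j)) x = Hom.lin (totπ K L k j n hkj) y ∧
        ‖x‖ ≤ C * ‖Hom.lin (totπ K L k j n hkj) y‖ by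
    obtain ⟨C, hC⟩ := H
    refine ⟨C * P, fun y h1 h2 h3 => ?_⟩
    obtain ⟨x, hx, hx'⟩ := hC y h1 h2 h3
    refine ⟨x, hx, hx'.trans ?_⟩
    rw [NNReal.coe_mul, mul_assoc]
    exact mul_le_mul_of_nonneg_left (hP y) C.2
  cases j with
  | zero =>
    obtain ⟨-, C, hC⟩ := hc.zero k
    obtain rfl : k = n := hkj
    exact ⟨C, fun y _ _ hy => hC _ hy⟩
  | succ j =>
    obtain ⟨-, C, hC⟩ := hc.succ k j
    refine ⟨C, fun y hy h0 _ => hC _ ?_⟩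
    have h1 := hy k j (by omega)
    rw [h0 (k + 1) j (by omega) le_rfl, map_zero, zero_add] at h1
    have h2 := congrArg (totSign k • ·) h1
    simpa only [smul_smul, Int.units_mul_self, one_smul, smul_zero] using h2

theorem ColumnsExact.exists_preimage_of_totπ_eq_zero (hc : ColumnsExact K L η) (n k : ℕ)
    (hk : k ≤ n + 1) : ∃ C : ℝ≥0, ∀ y : (tot K L).X n, IsTotCycle y →
      (∀ i j h, k ≤ i → Hom.lin (totπ K L i j n h) y = 0) →
      Hom.lin (tensorMap (𝟙 (K.X n)) η) (Hom.lin (totπ K L n 0 n rfl) y) = 0 →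
      ∃ x, Hom.lin ((tot K L).d (n + 1) n) x = y ∧ ‖x‖ ≤ C * ‖y‖ := by
  induction k with
  | zero =>
    refine ⟨0, fun y _ h0 _ => ⟨0, ?_, by simp⟩⟩
    rw [map_zero, eq_zero_of_totπ y fun i j h => h0 i j h (Nat.zero_le i)]
  | succ k ih =>
    obtain ⟨C, hC⟩ := ih (by omega)
    obtain ⟨j, hj⟩ : ∃ j, k + j = n := ⟨n - k, by omega⟩
    obtain ⟨C', hC'⟩ := hc.exists_column_preimage n k j hj
    obtain ⟨I, hI⟩ := Hom.isBdd (totι K L k (j + 1) (n + 1) (by omega))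
    obtain ⟨D, hD⟩ := Hom.isBdd ((tot K L).d (n + 1) n)
    refine ⟨C * (1 + D * I * C') + I * C', fun y hy h0 hη => ?_⟩
    obtain ⟨x, hx, hxy⟩ := hC' y hy h0 hη
    set z := Hom.lin (totι K L k (j + 1) (n + 1) (by omega)) (totSign k • x) with hz
    have hz' : ‖z‖ ≤ I * (C' * ‖y‖) := by
      refine (hI _).trans ?_
      rw [norm_units_smul]
      exact mul_le_mul_of_nonneg_left hxy I.2
    have h0' : ∀ i l (h : i + l = n), k ≤ i →
        Hom.lin (totπ K L i l n h) (y - Hom.lin ((tot K L).d (n + 1) n) z) = 0 := by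
      intro i l h hki
      rw [map_sub, lin_totπ_d h, hz, lin_totπ_totι_of_ne _ _ (by omega), map_zero, zero_add]
      obtain rfl | hne := eq_or_ne k i
      · obtain rfl : l = j := by omega
        rw [lin_totπ_totι]
        rw [map_units_smul, smul_smul, Int.units_mul_self, one_smul, hx, sub_self]
      · rw [lin_totπ_totι_of_ne _ _ hne, map_zero, smul_zero, sub_zero, h0 i l h (by omega)]
    obtain ⟨w, hw, hwy⟩ := hC (y - Hom.lin ((tot K L).d (n + 1) n) z) (hy.sub (isTotCycle_d z)) h0'
      (by rw [h0' n 0 rfl (by omega), map_zero])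
    refine ⟨w + z, by rw [map_add, hw, sub_add_cancel], (norm_add_le _ _).trans ?_⟩
    have h1 : ‖y - Hom.lin ((tot K L).d (n + 1) n) z‖ ≤ (1 + D * I * C') * ‖y‖ := by
      refine (norm_sub_le _ _).trans ?_
      have h2 := (hD z).trans (mul_le_mul_of_nonneg_left hz' D.2)
      linarith
    have h3 := hwy.trans (mul_le_mul_of_nonneg_left h1 C.2)
    push_cast
    linarith

theorem tensorMap_comm {M M' N N' : BanMod 𝒞 A} (f : M ⟶ M') (g : N ⟶ N') (x : tensor M N) :
    Hom.lin (tensorMap (𝟙 M') g) (Hom.lin (tensorMap f (𝟙 N)) x) =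
      Hom.lin (tensorMap f (𝟙 N')) (Hom.lin (tensorMap (𝟙 M) g) x) := by
  rw [← lin_comp, ← lin_comp, tensorMap_comp, tensorMap_comp, Category.comp_id, Category.id_comp,
    Category.id_comp, Category.comp_id]

theorem ColumnsExact.exists_preimage (hc : ColumnsExact K L η) (n : ℕ) :
    ∃ C : ℝ≥0, ∀ y : (tot K L).X n, IsTotCycle y → ∀ e : tensor (K.X (n + 1)) N,
      Hom.lin (tensorMap (K.d (n + 1) n) (𝟙 N)) e =
        Hom.lin (tensorMap (𝟙 (K.X n)) η) (Hom.lin (totπ K L n 0 n rfl) y) →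
      ∃ x, Hom.lin ((tot K L).d (n + 1) n) x = y ∧ ‖x‖ ≤ C * (‖y‖ + ‖e‖) := by
  obtain ⟨C, hC⟩ := hc.exists_preimage_of_totπ_eq_zero n (n + 1) le_rfl
  obtain ⟨S, hS⟩ := hc.surj (n + 1)
  obtain ⟨I, hI⟩ := Hom.isBdd (totι K L (n + 1) 0 (n + 1) rfl)
  obtain ⟨D, hD⟩ := Hom.isBdd ((tot K L).d (n + 1) n)
  refine ⟨C * (1 + D * I * S) + I * S, fun y hy e he => ?_⟩
  obtain ⟨x, rfl, hxe⟩ := hS e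
  set z := Hom.lin (totι K L (n + 1) 0 (n + 1) rfl) x with hz
  have hz' := (hI x).trans (mul_le_mul_of_nonneg_left hxe I.2)
  rw [← hz] at hz'
  obtain ⟨w, hw, hwy⟩ := hC (y - Hom.lin ((tot K L).d (n + 1) n) z) (hy.sub (isTotCycle_d z))
    (fun i j h hi => absurd h (by omega)) (by
      rw [map_sub, map_sub, lin_totπ_d (add_zero n), hz, lin_totπ_totι, lin_totπ_totι_of_ne _ _ (by omega),
        map_zero, smul_zero, map_add, map_zero, tensorMap_comm, he]
      exact (congrArg _ (add_zero _)).trans (sub_self _))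
  refine ⟨w + z, by rw [map_add, hw, sub_add_cancel], (norm_add_le _ _).trans ?_⟩
  set r := ‖Hom.lin (tensorMap (𝟙 (K.X (n + 1))) η) x‖
  have hr : 0 ≤ r := norm_nonneg _
  have h1 : ‖y - Hom.lin ((tot K L).d (n + 1) n) z‖ ≤ ‖y‖ + D * (I * (S * r)) :=
    (norm_sub_le _ _).trans (add_le_add_right ((hD z).trans (mul_le_mul_of_nonneg_left hz' D.2)) _)
  have h3 := hwy.trans (mul_le_mul_of_nonneg_left h1 C.2)
  have p1 : (0 : ℝ) ≤ C * r := by positivity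
  have p2 : (0 : ℝ) ≤ C * (D * (I * S)) * ‖y‖ := by positivity
  have p3 : (0 : ℝ) ≤ I * S * ‖y‖ := by positivity
  push_cast
  linarith

theorem le_mul_of_le_mul_add {C E P : ℝ≥0} {x a b c : ℝ} (hx : x ≤ C * (a + b)) (hb : b ≤ E * c)
    (hc : c ≤ P * a) : x ≤ (C * (1 + E * P) : ℝ≥0) * a := by
  have h1 := hb.trans (mul_le_mul_of_nonneg_left hc E.coe_nonneg)
  refine hx.trans ((mul_le_mul_of_nonneg_left (add_le_add_right h1 _) C.coe_nonneg).trans_eq ?_)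
  push_cast
  ring

theorem ColumnsExact.bddExact_tot (hc : ColumnsExact K L η) (n : ℕ)
    (hr : BddExact (tensorMap (K.d (n + 2) (n + 1)) (𝟙 N)) (tensorMap (K.d (n + 1) n) (𝟙 N))) :
    BddExact ((tot K L).d (n + 2) (n + 1)) ((tot K L).d (n + 1) n) := by
  obtain ⟨C, hC⟩ := hc.exists_preimage (n + 1)
  obtain ⟨-, E, hE⟩ := hr
  obtain ⟨P, hP⟩ := Hom.isBdd (totπ K L (n + 1) 0 (n + 1) rfl ≫ tensorMap (𝟙 (K.X (n + 1))) η)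
  refine ⟨(tot K L).d_comp_d _ _ _, C * (1 + E * P), fun y hy => ?_⟩
  have hcy := isTotCycle_of_d_eq_zero y hy
  obtain ⟨e, he, hey⟩ := hE (Hom.lin (tensorMap (𝟙 (K.X (n + 1))) η)
      (Hom.lin (totπ K L (n + 1) 0 (n + 1) rfl) y)) (by
    rw [← tensorMap_comm, eq_neg_of_add_eq_zero_left (hcy n 0 rfl), map_neg, map_units_smul,
      lin_lin_eq_zero (hc.zero n).1, smul_zero, neg_zero])
  obtain ⟨x, hx, hxy⟩ := hC y hcy e he
  exact ⟨x, hx, le_mul_of_le_mul_add hxy hey (hP y)⟩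

theorem ColumnsExact.bddExact_tot_zero (hc : ColumnsExact K L η) {Q : BanMod 𝒞 A}
    (μ : tensor (K.X 0) N ⟶ Q) (hr : BddExact (tensorMap (K.d 1 0) (𝟙 N)) μ) :
    BddExact ((tot K L).d 1 0) (totπ K L 0 0 0 rfl ≫ tensorMap (𝟙 (K.X 0)) η ≫ μ) := by
  obtain ⟨C, hC⟩ := hc.exists_preimage 0
  obtain ⟨hr0, E, hE⟩ := hr
  obtain ⟨P, hP⟩ := Hom.isBdd (totπ K L 0 0 0 rfl ≫ tensorMap (𝟙 (K.X 0)) η)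
  refine ⟨hom_ext fun y => ?_, C * (1 + E * P), fun y hy => ?_⟩
  · rw [lin_comp, lin_comp, lin_comp, lin_totπ_d rfl, map_add, map_add, tensorMap_comm,
      lin_lin_eq_zero hr0, zero_add, map_units_smul, lin_lin_eq_zero (hc.zero 0).1, smul_zero,
      map_zero, lin_zero]
  · have hcy : IsTotCycle y := fun i j h => absurd h (by omega)
    obtain ⟨e, he, hey⟩ := hE (Hom.lin (tensorMap (𝟙 (K.X 0)) η)
      (Hom.lin (totπ K L 0 0 0 rfl) y)) hy
    obtain ⟨x, hx, hxy⟩ := hC y hcy e he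
    exact ⟨x, hx, le_mul_of_le_mul_add hxy hey (hP y)⟩

end Total

end BanachGeometry

namespace BanachGeometry

open BanMod

variable {𝒞 : Ambient} {A : Type u} [NormedCommRing A]

/-! ## Resolutions as quasi-isomorphisms -/

namespace BanMod

theorem eq_zero_of_isZero {M : BanMod 𝒞 A} (h : IsZero M) (x : M) : x = 0 := by
  rw [← lin_id M x, (IsZero.iff_id_eq_zero M).1 h, lin_zero]

theorem lin_inv_lin_hom {M N : BanMod 𝒞 A} (α : M ≅ N) (x : M) :
    Hom.lin α.inv (Hom.lin α.hom x) = x := by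
  rw [← lin_comp, α.hom_inv_id, lin_id]

theorem lin_hom_lin_inv {M N : BanMod 𝒞 A} (α : M ≅ N) (x : N) :
    Hom.lin α.hom (Hom.lin α.inv x) = x := by
  rw [← lin_comp, α.inv_hom_id, lin_id]

/-- Every element has a preimage, with a bound. -/
def BddSurjective {M N : BanMod 𝒞 A} (f : M ⟶ N) : Prop :=
  ∃ C : ℝ≥0, ∀ y, ∃ x, Hom.lin f x = y ∧ ‖x‖ ≤ C * ‖y‖

theorem BddSurjective.of_iso {M N M' N' : BanMod 𝒞 A} {f : M ⟶ N} (h : BddSurjective f)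
    (α : M' ≅ M) (β : N' ≅ N) : BddSurjective (α.hom ≫ f ≫ β.inv) := by
  obtain ⟨C, hC⟩ := h
  obtain ⟨D, hD⟩ := Hom.isBdd α.inv
  obtain ⟨E, hE⟩ := Hom.isBdd β.hom
  refine ⟨D * C * E, fun y => ?_⟩
  obtain ⟨x, hx, hxy⟩ := hC (Hom.lin β.hom y)
  refine ⟨Hom.lin α.inv x, ?_, ?_⟩
  · rw [lin_comp, lin_comp, lin_hom_lin_inv, hx, lin_inv_lin_hom]
  · calc _ ≤ D * ‖x‖ := hD x
      _ ≤ D * (C * (E * ‖y‖)) := by gcongr; exact hxy.trans (by gcongr; exact hE y)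
      _ = _ := by push_cast; ring

theorem BddExact.of_iso {M N P M' N' P' : BanMod 𝒞 A} {f : M ⟶ N} {g : N ⟶ P} (h : BddExact f g)
    (α : M' ≅ M) (β : N' ≅ N) (γ : P' ≅ P) :
    BddExact (α.hom ≫ f ≫ β.inv) (β.hom ≫ g ≫ γ.inv) := by
  obtain ⟨h0, C, hC⟩ := h
  obtain ⟨D, hD⟩ := Hom.isBdd α.inv
  obtain ⟨E, hE⟩ := Hom.isBdd β.hom
  refine ⟨?_, D * C * E, fun y hy => ?_⟩
  · simp only [Category.assoc, Iso.inv_hom_id_assoc]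
    rw [← Category.assoc f, h0, zero_comp, comp_zero]
  · rw [lin_comp, lin_comp] at hy
    have hy' : Hom.lin g (Hom.lin β.hom y) = 0 := by
      rw [← lin_hom_lin_inv γ (Hom.lin g _), hy, map_zero]
    obtain ⟨x, hx, hxy⟩ := hC _ hy'
    refine ⟨Hom.lin α.inv x, ?_, ?_⟩
    · rw [lin_comp, lin_comp, lin_hom_lin_inv, hx, lin_inv_lin_hom]
    · calc _ ≤ D * ‖x‖ := hD x
        _ ≤ D * (C * (E * ‖y‖)) := by gcongr; exact hxy.trans (by gcongr; exact hE y)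
        _ = _ := by push_cast; ring

end BanMod

section Cone

open CochainComplex HomComplex

theorem strictlyExact_mappingCone {F G : CochainComplex (BanMod 𝒞 A) ℤ} (φ : F ⟶ G)
    (hG : ∀ i j, G.d i j = 0)
    (h : ∀ j k l : ℤ, j + 1 = k → k + 1 = l → ∃ C : ℝ≥0, ∀ (a : F.X k) (b : G.X j),
      Hom.lin (F.d k l) a = 0 → Hom.lin (φ.f k) a = 0 →
      ∃ a' : F.X j, Hom.lin (F.d j k) a' = -a ∧ Hom.lin (φ.f j) a' = b ∧
        ‖a'‖ ≤ C * (‖a‖ + ‖b‖)) : IsQuasiIso φ := by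
  intro i j k hij hjk
  refine BddExact.strictlyExactAt ⟨HomologicalComplex.d_comp_d _ _ _ _, ?_⟩
  obtain ⟨C, hC⟩ := h j k (k + 1) hjk rfl
  set p := (mappingCone.fst φ).1.v j k hjk
  set q := (mappingCone.snd φ).v j j (add_zero j)
  set ι := (mappingCone.inl φ).v j i (by lia)
  obtain ⟨P, hP⟩ := Hom.isBdd p
  obtain ⟨Q, hQ⟩ := Hom.isBdd q
  obtain ⟨I, hI⟩ := Hom.isBdd ι
  refine ⟨I * (C * (P + Q)), fun z hz => ?_⟩
  have h1 : Hom.lin (F.d k (k + 1)) (Hom.lin p z) = 0 := by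
    have e := mappingCone.d_fst_v φ j k (k + 1) hjk rfl
    have e' := congrArg (fun f => Hom.lin f z) e
    simp only [lin_comp, hz, map_zero, lin_neg] at e'
    exact neg_eq_zero.1 e'.symm
  have h2 : Hom.lin (φ.f k) (Hom.lin p z) = 0 := by
    have e := mappingCone.d_snd_v φ j k hjk
    rw [hG, comp_zero, add_zero] at e
    have e' := congrArg (fun f => Hom.lin f z) e
    simp only [lin_comp, hz, map_zero] at e'
    exact e'.symm
  obtain ⟨a', ha1, ha2, ha3⟩ := hC _ (Hom.lin q z) h1 h2
  refine ⟨Hom.lin ι a', ?_, ?_⟩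
  · have e := mappingCone.inl_v_d φ j i k (by lia) (by lia)
    have e' := congrArg (fun f => Hom.lin f a') e
    rw [sub_eq_add_neg] at e'
    simp only [lin_comp, lin_add, lin_neg, ha1, ha2, map_neg, neg_neg] at e'
    refine e'.trans ?_
    have e2 := congrArg (fun f => Hom.lin f z) (mappingCone.id_X φ j k hjk)
    simp only [lin_add, lin_comp, lin_id] at e2
    exact (add_comm _ _).trans e2
  · calc _ ≤ I * ‖a'‖ := hI a'
      _ ≤ I * (C * (P * ‖z‖ + Q * ‖z‖)) := by
        gcongr
        refine ha3.trans ?_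
        gcongr
        exacts [hP z, hQ z]
      _ = _ := by push_cast; ring

theorem isQuasiIso_extendMap {T S : ChainComplex (BanMod 𝒞 A) ℕ} (φ : T ⟶ S)
    (hS : ∀ n, n ≠ 0 → IsZero (S.X n))
    (h : ∀ n, BddExact (T.d (n + 2) (n + 1)) (T.d (n + 1) n)) (h0 : BddExact (T.d 1 0) (φ.f 0))
    (hs : BddSurjective (φ.f 0)) :
    IsQuasiIso (HomologicalComplex.extendMap φ ComplexShape.embeddingDownNat) := by
  set e := ComplexShape.embeddingDownNat
  set F := T.extend e
  set G := S.extend e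
  have he : ∀ n : ℕ, e.f n = -(n : ℤ) := fun n => rfl
  have hF : ∀ j : ℤ, 0 < j → IsZero (F.X j) := fun j hj =>
    T.isZero_extend_X e j fun i => by rw [he]; omega
  have hGz : ∀ j : ℤ, j ≠ 0 → IsZero (G.X j) := by
    intro j hj
    by_cases hj' : ∃ n, e.f n = j
    · obtain ⟨n, rfl⟩ := hj'
      have hn : n ≠ 0 := by
        rintro rfl
        exact hj rfl
      exact (hS n hn).of_iso (S.extendXIso e rfl)
    · exact S.isZero_extend_X e j fun i hi => hj' ⟨i, hi⟩
  refine strictlyExact_mappingCone _ (fun i j => ?_) fun j k l hjk hkl => ?_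
  · by_cases hij : i + 1 = j
    · by_cases hi : i = 0
      · exact (hGz j (by omega)).eq_of_tgt _ _
      · exact (hGz i hi).eq_of_src _ _
    · exact HomologicalComplex.shape _ _ _ hij
  obtain hj | rfl | hj := lt_trichotomy 0 j
  · refine ⟨0, fun a b _ _ => ⟨0, ?_, ?_, by simp⟩⟩
    · rw [eq_zero_of_isZero (hF k (by omega)) a, map_zero, neg_zero]
    · rw [eq_zero_of_isZero (hGz j (by omega)) b, map_zero]
  · obtain ⟨C, hC⟩ := hs.of_iso (T.extendXIso e (he 0)) (S.extendXIso e (he 0))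
    rw [← HomologicalComplex.extendMap_f] at hC
    refine ⟨C, fun a b _ _ => ?_⟩
    obtain ⟨x, hx, hxb⟩ := hC b
    refine ⟨x, ?_, hx, hxb.trans ?_⟩
    · rw [eq_zero_of_isZero (hF k (by omega)) a, neg_zero, eq_zero_of_isZero (hF k (by omega)) (Hom.lin _ x)]
    · gcongr
      exact le_add_of_nonneg_left (norm_nonneg a)
  · have key : ∃ C : ℝ≥0, ∀ a : F.X k, Hom.lin (F.d k l) a = 0 →
        Hom.lin ((HomologicalComplex.extendMap φ e).f k) a = 0 →
        ∃ a' : F.X j, Hom.lin (F.d j k) a' = a ∧ ‖a'‖ ≤ C * ‖a‖ := by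
      obtain ⟨n, hn⟩ : ∃ n : ℕ, e.f n = k := ⟨(-k).toNat, by rw [he]; omega⟩
      have hn' : e.f (n + 1) = j := by
        rw [he] at hn ⊢
        push_cast
        omega
      cases n with
      | zero =>
        obtain ⟨-, C, hC⟩ := h0.of_iso (T.extendXIso e hn') (T.extendXIso e hn) (S.extendXIso e hn)
        rw [← HomologicalComplex.extendMap_f, ← HomologicalComplex.extend_d_eq] at hC
        exact ⟨C, fun a _ ha => hC a ha⟩
      | succ n =>
        have hl : e.f n = l := by
          rw [he] at hn ⊢
          push_cast at hn
          omega
        obtain ⟨-, C, hC⟩ := (h n).of_iso (T.extendXIso e hn') (T.extendXIso e hn)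
          (T.extendXIso e hl)
        rw [← HomologicalComplex.extend_d_eq, ← HomologicalComplex.extend_d_eq] at hC
        exact ⟨C, fun a ha _ => hC a ha⟩
    obtain ⟨C, hC⟩ := key
    refine ⟨C, fun a b ha ha' => ?_⟩
    obtain ⟨x, hx, hxa⟩ := hC a ha ha'
    refine ⟨-x, by rw [map_neg, hx], ?_, ?_⟩
    · rw [eq_zero_of_isZero (hGz j (by omega)) b, eq_zero_of_isZero (hGz j (by omega)) (Hom.lin _ (-x))]
    · rw [norm_neg]
      refine hxa.trans ?_
      gcongr
      exact le_add_of_nonneg_right (norm_nonneg b)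

theorem isIso_toDMinus_map (T : ChainComplex (BanMod 𝒞 A) ℕ) (Q : BanMod 𝒞 A)
    (φ : T ⟶ (ChainComplex.single₀ (BanMod 𝒞 A)).obj Q)
    (h : ∀ n, BddExact (T.d (n + 2) (n + 1)) (T.d (n + 1) n)) (h0 : BddExact (T.d 1 0) (φ.f 0))
    (hs : BddSurjective (φ.f 0)) : IsIso ((toDMinus 𝒞 A).map φ) :=
  Localization.inverts (quasiIsos 𝒞 A).Q (quasiIsos 𝒞 A) ((toKMinus 𝒞 A).map φ)
    ⟨HomologicalComplex.extendMap φ ComplexShape.embeddingDownNat,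
      isQuasiIso_extendMap φ (HomologicalComplex.isZero_single_obj_X (ComplexShape.down ℕ) 0 Q)
        h h0 hs, rfl⟩

end Cone

/-! ## The derived tensor square of a cyclic module -/

section DerivedTensor

variable [Ultra 𝒞 A]

theorem columnsExact_resolution (M N : BanMod 𝒞 A) :
    ColumnsExact (resolution M) (resolution N) (augmentation N) where
  succ i j := ((relExact_resolution N j).approxExact_free_tensor (syzygy M i)).bddExact
  zero i := ((relExact_augmentation N).approxExact_free_tensor (syzygy M i)).bddExact
  surj i := by
    obtain ⟨-, C, hC⟩ := (approxExact_free_tensor_zero (P := N) _ (exists_counit_eq N)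
      (syzygy M i)).bddExact
    exact ⟨C, fun y => hC y rfl⟩

/-- If `- ⊗̂ N` is exact in the sense of `IsFlatGenerator` and `μ : M ⊗̂ N → M` satisfies
`μ (x ⊗ e) = x`, then the morphism `M ⊗̂ᴸ N → M` induced by `μ` is an isomorphism. -/
theorem isIso_derivedTensorMap {M N : BanMod 𝒞 A} {e : N} (h : IsFlatGenerator N e)
    (μ : tensor M N ⟶ M) (hμ : ∀ x, Hom.lin μ (tmul x e) = x) : IsIso (derivedTensorMap μ) := by
  have hc := columnsExact_resolution M N
  have hrow : BddExact (tensorMap ((resolution M).d 1 0) (𝟙 N))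
      (tensorMap (augmentation M) (𝟙 N) ≫ μ) :=
    (h.approxExact_tensor_of_tmul (relExact_augmentation M) _ fun p => by
      rw [lin_comp, tensorMap_tmul, lin_id, hμ]).bddExact
  have hdesc : totπ (resolution M) (resolution N) 0 0 0 rfl ≫
      tensorMap (𝟙 _) (augmentation N) ≫ tensorMap (augmentation M) (𝟙 N) ≫ μ =
        totTensorDesc μ := by
    refine tot_hom_ext fun i j hij => ?_
    obtain ⟨rfl, rfl⟩ : i = 0 ∧ j = 0 := by omega
    rw [← Category.assoc, totι_totπ, Category.id_comp, ← Category.assoc, tensorMap_comp,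
      Category.id_comp, Category.comp_id]
    exact (HomologicalComplex.ι_mapBifunctorDesc (K₁ := resolution M) (K₂ := resolution N)
      (F := tensorFunctor 𝒞 A) (c := ComplexShape.down ℕ)
      (fun i j _ => totTensorComponent μ i j) 0 0 hij).symm
  have hf : (totTensorMap μ).f 0 = totTensorDesc μ :=
    ChainComplex.toSingle₀Equiv_symm_apply_f_zero _ _
  have hsurj : BddSurjective (totπ (resolution M) (resolution N) 0 0 0 rfl ≫
      tensorMap (𝟙 _) (augmentation N) ≫ tensorMap (augmentation M) (𝟙 N) ≫ μ) := by
    obtain ⟨I, hI⟩ := Hom.isBdd (totι (resolution M) (resolution N) 0 0 0 rfl)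
    obtain ⟨S, hS⟩ := hc.surj 0
    set c : ℝ≥0 := ‖(1 : A)‖₊
    refine ⟨I * (S * (c * ‖e‖₊)), fun y => ?_⟩
    obtain ⟨p, hp, hpy⟩ : ∃ p : (resolution M).X 0, Hom.lin (augmentation M) p = y ∧
        ‖p‖ ≤ ‖(1 : A)‖₊ * ‖y‖ := exists_counit_eq M y
    obtain ⟨x, hx, hxp⟩ := hS (tmul p e)
    refine ⟨Hom.lin (totι (resolution M) (resolution N) 0 0 0 rfl) x, ?_, ?_⟩
    · rw [lin_comp, lin_comp, lin_totπ_totι, hx, lin_comp, tensorMap_tmul, lin_id, hμ, hp]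
    · calc _ ≤ I * ‖x‖ := hI x
        _ ≤ I * (S * (c * ‖y‖ * ‖e‖)) := by
          gcongr
          refine hxp.trans ?_
          gcongr
          exact (norm_tmul_le _ _).trans (by gcongr)
        _ = _ := by push_cast; ring
  refine isIso_toDMinus_map _ _ _ (fun n => ?_) ?_ ?_
  · exact hc.bddExact_tot n (h.approxExact_tensor (relExact_resolution M n)).bddExact
  · have h1 := hc.bddExact_tot_zero _ hrow
    rw [hdesc] at h1
    rw [hf]
    exact h1
  · rw [hf, ← hdesc]
    exact hsurj

/-- A surjection with bounded lifts whose kernel has a bounded approximate identity is a homotopy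
epimorphism. -/
theorem BanAlg.isHomotopyEpi_of_exists_mul_le {R : Type v} [NormedCommRing R]
    {A B : BanAlg.{u} 𝒞 R} (π : A ⟶ B)
    (hlift : ∃ C : ℝ≥0, ∀ b : B, ∃ a : A, BanAlg.Hom.alg π a = b ∧ ‖a‖ ≤ C * ‖b‖)
    (hker : ∃ D : ℝ≥0, ∀ s : Finset A, (∀ i ∈ s, BanAlg.Hom.alg π i = 0) → ∀ δ : ℝ, 0 < δ →
      ∃ a : A, BanAlg.Hom.alg π a = 1 ∧ ‖a‖ ≤ D ∧ ∀ i ∈ s, ‖a * i‖ ≤ δ) :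
    BanAlg.IsHomotopyEpi π := by
  let e : BanAlg.asModule π := (1 : B)
  have hsmul : ∀ a : A, a • e = (BanAlg.Hom.alg π a : B) := fun a => mul_one (M := B) _
  have h : IsFlatGenerator (BanAlg.asModule π) e := by
    constructor
    · obtain ⟨C, hC⟩ := hlift
      refine ⟨C, fun b => ?_⟩
      obtain ⟨a, ha, hab⟩ := hC b
      exact ⟨a, (hsmul a).trans ha, hab⟩
    · obtain ⟨D, hD⟩ := hker
      refine ⟨D, fun s hs δ hδ => ?_⟩
      obtain ⟨a, ha, hab⟩ := hD s (fun i hi => (hsmul i).symm.trans (hs i hi)) δ hδ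
      exact ⟨a, (hsmul a).trans ha, hab⟩
  exact isIso_derivedTensorMap h (BanAlg.mul π) fun x =>
    (tensorLift_tmul (M := BanAlg.asModule π) (N := BanAlg.asModule π) (P := BanAlg.asModule π)
      _ _ x e).trans (mul_one (M := B) x)

end DerivedTensor

end BanachGeometry

namespace BanachGeometry

open BanMod

/-! ## Extension and separation for algebras of continuous functions -/

section Functions

variable {X : Type u} [TopologicalSpace X] [CompactSpace X] {R : Type v} [NormedField R]

/-- Disjoint closed subsets can be separated by functions of norm at most one. -/
def HasSeparation (X : Type u) [TopologicalSpace X] (R : Type v) [NormedField R] : Prop :=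
  ∀ S T : Set X, IsClosed S → IsClosed T → Disjoint S T →
    ∃ f : C(X, R), (∀ x ∈ S, f x = 1) ∧ (∀ x ∈ T, f x = 0) ∧ ∀ x, ‖f x‖ ≤ 1

/-- Functions on closed subsets can be extended with a bound on the norm. -/
def HasBddExtension (X : Type u) [TopologicalSpace X] [CompactSpace X] (R : Type v)
    [NormedField R] : Prop :=
  ∀ K : TopologicalSpace.Closeds X, ∃ C : ℝ≥0, ∀ f : C(K, R), ∃ g : C(X, R),
    (∀ x : K, g x = f x) ∧ ‖g‖ ≤ C * ‖f‖

theorem HasSeparation.exists_mul_le (h : HasSeparation X R) (K : TopologicalSpace.Closeds X)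
    (s : Finset C(X, R)) (hs : ∀ i ∈ s, ∀ x ∈ K, i x = 0) {δ : ℝ} (hδ : 0 < δ) :
    ∃ f : C(X, R), (∀ x ∈ K, f x = 1) ∧ ‖f‖ ≤ 1 ∧ ∀ i ∈ s, ‖f * i‖ ≤ δ := by
  obtain ⟨f, h1, h0, hf⟩ := h K (⋃ i ∈ s, {x | δ ≤ ‖i x‖}) K.isClosed
    (s.finite_toSet.isClosed_biUnion fun i _ => isClosed_le continuous_const (by fun_prop)) (by
      rw [Set.disjoint_left]
      intro x hx hx'
      simp only [Set.mem_iUnion] at hx'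
      obtain ⟨i, hi, hix⟩ := hx'
      have hix : δ ≤ ‖i x‖ := hix
      rw [hs i hi x hx, norm_zero] at hix
      exact absurd hix (not_le.2 hδ))
  refine ⟨f, h1, (ContinuousMap.norm_le _ zero_le_one).2 hf, fun i hi =>
    (ContinuousMap.norm_le _ hδ.le).2 fun x => ?_⟩
  rw [ContinuousMap.mul_apply, norm_mul]
  by_cases hx : δ ≤ ‖i x‖
  · rw [h0 x (Set.mem_biUnion (show i ∈ (s : Set _) from hi) hx), norm_zero, zero_mul]
    exact hδ.le
  · calc ‖f x‖ * ‖i x‖ ≤ 1 * δ := by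
          gcongr
          exacts [hf x, (not_le.1 hx).le]
      _ = δ := one_mul δ

theorem isHomotopyEpi_restriction (𝒞 : Ambient) [CompleteSpace R] [Ultra 𝒞 R]
    (hsep : HasSeparation X R) (hext : HasBddExtension X R) (K : TopologicalSpace.Closeds X) :
    BanAlg.IsHomotopyEpi (restriction 𝒞 R K) := by
  refine BanAlg.isHomotopyEpi_of_exists_mul_le _ ?_ ⟨1, fun s hs δ hδ => ?_⟩
  · obtain ⟨C, hC⟩ := hext K
    refine ⟨C, fun f => ?_⟩
    obtain ⟨g, hg, hgf⟩ := hC f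
    exact ⟨g, ContinuousMap.ext hg, hgf⟩
  · obtain ⟨f, h1, hf, hfs⟩ := hsep.exists_mul_le K s
      (fun i hi x hx => DFunLike.congr_fun (F := C(K, R)) (hs i hi) ⟨x, hx⟩) hδ
    exact ⟨f, ContinuousMap.ext fun x => h1 x x.2, hf, hfs⟩

/-! ### The Archimedean case -/

theorem hasSeparation_of_real [T2Space X] (j : ℝ →+* R) (hj : ∀ t, ‖j t‖ = ‖t‖) :
    HasSeparation X R := by
  intro S T hS hT hd
  obtain ⟨f, h0, h1, hf⟩ := exists_continuous_zero_one_of_isClosed hT hS hd.symm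
  have hjc : Continuous j := (AddMonoidHomClass.isometry_of_norm j hj).continuous
  refine ⟨⟨fun x => j (f x), hjc.comp f.continuous⟩, fun x hx => ?_, fun x hx => ?_, fun x => ?_⟩
  · exact (congrArg j (h1 hx)).trans (map_one j)
  · exact (congrArg j (h0 hx)).trans (map_zero j)
  · refine (hj (f x)).trans_le ?_
    rw [Real.norm_of_nonneg (hf x).1]
    exact (hf x).2

theorem hasBddExtension_of_real [T2Space X] [TietzeExtension.{u, v} R] (j : ℝ →+* R)
    (hj : ∀ t, ‖j t‖ = ‖t‖) : HasBddExtension X R := by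
  refine fun K => ⟨1, fun f => ?_⟩
  by_cases hf : f = 0
  · exact ⟨0, fun x => by simp [hf], by simp [hf]⟩
  obtain ⟨g, hg⟩ := ContinuousMap.exists_restrict_eq K.isClosed f
  have hgf : ∀ x : K, g x = f x := fun x => DFunLike.congr_fun hg x
  have hc : 0 < ‖f‖ := norm_pos_iff.2 hf
  have hm : ∀ x, 0 < max ‖f‖ ‖g x‖ := fun x => lt_max_of_lt_left hc
  have hjc : Continuous j := (AddMonoidHomClass.isometry_of_norm j hj).continuous
  refine ⟨⟨fun x => j (‖f‖ / max ‖f‖ ‖g x‖) * g x, ?_⟩, fun x => ?_, ?_⟩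
  · exact (hjc.comp (continuous_const.div (by fun_prop) fun x => (hm x).ne')).mul g.continuous
  · have h1 : ‖g x‖ ≤ ‖f‖ := by
      rw [hgf]
      exact f.norm_coe_le_norm x
    change j _ * g x = f x
    rw [max_eq_left h1, div_self hc.ne', map_one, one_mul, hgf]
  · rw [NNReal.coe_one, one_mul]
    refine (ContinuousMap.norm_le _ hc.le).2 fun x => ?_
    change ‖j _ * g x‖ ≤ _
    rw [norm_mul, hj, Real.norm_of_nonneg (div_nonneg hc.le (hm x).le), div_mul_eq_mul_div,
      div_le_iff₀ (hm x)]
    exact mul_le_mul_of_nonneg_left (le_max_right _ _) hc.le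

theorem hasSeparation_and_hasBddExtension_of_arch [T2Space X] (h : IsAdmissiblePair .arch R) :
    HasSeparation X R ∧ HasBddExtension X R := by
  obtain ⟨e, he⟩ | ⟨e, he⟩ := h
  · have hiso : Isometry e := AddMonoidHomClass.isometry_of_norm e he
    have : TietzeExtension.{u, v} R :=
      TietzeExtension.of_homeo (IsometryEquiv.mk e.toEquiv hiso).toHomeomorph
    have hj : ∀ t, ‖(e.symm : ℝ →+* R) t‖ = ‖t‖ := fun t => by
      rw [← he]
      exact congrArg norm (e.apply_symm_apply t)
    exact ⟨hasSeparation_of_real _ hj, hasBddExtension_of_real _ hj⟩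
  · have hiso : Isometry e := AddMonoidHomClass.isometry_of_norm e he
    have : TietzeExtension.{u, v} R :=
      TietzeExtension.of_homeo (IsometryEquiv.mk e.toEquiv hiso).toHomeomorph
    have hj : ∀ t, ‖((e.symm : ℂ →+* R).comp Complex.ofRealHom) t‖ = ‖t‖ := fun t => by
      rw [← he]
      exact (congrArg norm (e.apply_symm_apply (t : ℂ))).trans (Complex.norm_real t)
    exact ⟨hasSeparation_of_real _ hj, hasBddExtension_of_real _ hj⟩

/-! ### The non-Archimedean case -/

theorem hasSeparation_of_totallyDisconnected [T2Space X] [TotallyDisconnectedSpace X] :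
    HasSeparation X R := by
  intro S T hS hT hd
  obtain ⟨W, hW, hSW, hWT⟩ := exists_clopen_of_closed_subset_open hS hT.isOpen_compl
    (Set.disjoint_left.1 hd)
  refine ⟨⟨W.indicator 1, continuous_one.indicator (by simp [hW.frontier_eq])⟩,
    fun x hx => Set.indicator_of_mem (hSW hx) _,
    fun x hx => Set.indicator_of_notMem (fun h => hWT h hx) _, fun x => ?_⟩
  refine (norm_indicator_le_norm_self (1 : X → R) x).trans ?_
  simp

theorem exists_approx_extension [T2Space X] [TotallyDisconnectedSpace X]
    (K : TopologicalSpace.Closeds X) (f : C(K, R)) {ε : ℝ} (hε : 0 < ε) :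
    ∃ g : C(X, R), ∀ x : K, ‖g x - f x‖ < ε := by
  classical
  have hU : ∀ a : K, ∃ U : Set X, IsClopen U ∧ (a : X) ∈ U ∧ ∀ x : K, (x : X) ∈ U →
      ‖f a - f x‖ < ε := by
    intro a
    have h1 : {x : K | ‖f a - f x‖ < ε} ∈ nhds a :=
      (isOpen_lt (by fun_prop) continuous_const).mem_nhds (by simpa using hε)
    rw [nhds_subtype_eq_comap, Filter.mem_comap] at h1
    obtain ⟨V, hV, hVs⟩ := h1
    obtain ⟨U, ⟨haU, hUc⟩, hUV⟩ := (nhds_basis_clopen (a : X)).mem_iff.1 hV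
    exact ⟨U, hUc, haU, fun x hx => hVs (hUV hx)⟩
  choose U hUc haU hUf using hU
  have hfin : ∀ t : Finset K, ∃ g : C(X, R), ∀ x : K, (∃ a ∈ t, (x : X) ∈ U a) →
      ‖g x - f x‖ < ε := by
    intro t
    induction t using Finset.induction_on with
    | empty => exact ⟨0, by simp⟩
    | insert a t _ ih =>
      obtain ⟨g, hg⟩ := ih
      refine ⟨⟨(U a).piecewise (fun _ => f a) g, continuous_const.piecewise
        (by simp [(hUc a).frontier_eq]) g.continuous⟩, fun x hx => ?_⟩
      by_cases hxa : (x : X) ∈ U a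
      · change ‖(U a).piecewise (fun _ => f a) g x - f x‖ < ε
        rw [Set.piecewise_eq_of_mem _ _ _ hxa]
        exact hUf a x hxa
      · change ‖(U a).piecewise (fun _ => f a) g x - f x‖ < ε
        rw [Set.piecewise_eq_of_notMem _ _ _ hxa]
        obtain ⟨b, hb, hxb⟩ := hx
        obtain rfl | hb := Finset.mem_insert.1 hb
        · exact absurd hxb hxa
        · exact hg x ⟨b, hb, hxb⟩
  obtain ⟨t, ht⟩ := isCompact_univ.elim_finite_subcover (fun a : K => Subtype.val ⁻¹' U a)
    (fun a => (hUc a).isOpen.preimage continuous_subtype_val) fun x _ =>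
      Set.mem_iUnion.2 ⟨x, haU x⟩
  obtain ⟨g, hg⟩ := hfin t
  refine ⟨g, fun x => hg x ?_⟩
  obtain ⟨a, ha, hxa⟩ := Set.mem_iUnion₂.1 (ht (Set.mem_univ x))
  exact ⟨a, ha, hxa⟩

/-- The restriction to a closed subset as a homomorphism of normed groups. -/
noncomputable def restrictHom (K : TopologicalSpace.Closeds X) (R : Type v) [NormedField R] :
    NormedAddGroupHom C(X, R) C(K, R) where
  toFun f := f.comp ⟨(Subtype.val : K → X), continuous_subtype_val⟩
  map_add' _ _ := rfl
  bound' := ⟨1, fun f => by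
    rw [one_mul]
    exact (ContinuousMap.norm_le _ (norm_nonneg f)).2 fun x => f.norm_coe_le_norm x.1⟩

theorem surjectiveOnWith_restrictHom [IsUltrametricDist R] (K : TopologicalSpace.Closeds X) :
    (restrictHom K R).SurjectiveOnWith (restrictHom K R).range 1 := by
  rintro _ ⟨g, rfl⟩
  change ∃ g' : C(X, R), restrictHom K R g' = restrictHom K R g ∧ ‖g'‖ ≤ 1 * ‖restrictHom K R g‖
  rw [one_mul]
  by_cases hc : restrictHom K R g = 0
  · exact ⟨0, by rw [hc, map_zero], by simp⟩
  set c := ‖restrictHom K R g‖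
  have hW : IsClopen {x | ‖g x‖ ≤ c} := by
    have := (IsUltrametricDist.isClopen_closedBall (0 : R) (norm_ne_zero_iff.2 hc)).preimage
      g.continuous
    simpa [Set.preimage, Metric.mem_closedBall, dist_zero_right] using this
  refine ⟨⟨Set.indicator {x | ‖g x‖ ≤ c} g, g.continuous.indicator (by simp [hW.frontier_eq])⟩,
    ContinuousMap.ext fun x => ?_, (ContinuousMap.norm_le _ (norm_nonneg _)).2 fun x => ?_⟩
  · exact Set.indicator_of_mem (s := {x | ‖g x‖ ≤ c})
      ((restrictHom K R g).norm_coe_le_norm x) g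
  · change ‖Set.indicator {x | ‖g x‖ ≤ c} g x‖ ≤ c
    by_cases hx : ‖g x‖ ≤ c
    · rw [Set.indicator_of_mem (s := {x | ‖g x‖ ≤ c}) hx]
      exact hx
    · rw [Set.indicator_of_notMem (s := {x | ‖g x‖ ≤ c}) hx, norm_zero]
      exact norm_nonneg _

theorem hasBddExtension_of_totallyDisconnected [T2Space X] [TotallyDisconnectedSpace X]
    [CompleteSpace R] [IsUltrametricDist R] : HasBddExtension X R := by
  refine fun K => ⟨1 + 1, fun f => ?_⟩
  have hf : f ∈ (restrictHom K R).range.topologicalClosure := by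
    refine Metric.mem_closure_iff.2 fun ε hε => ?_
    obtain ⟨g, hg⟩ := exists_approx_extension K f hε
    refine ⟨restrictHom K R g, ⟨g, rfl⟩, ?_⟩
    rw [dist_comm]
    exact (ContinuousMap.dist_lt_iff hε).2 fun x => by
      rw [dist_eq_norm]
      exact hg x
  obtain ⟨g, hg, hgf⟩ := controlled_closure_of_complete one_pos one_pos
    (surjectiveOnWith_restrictHom (R := R) K) f hf
  exact ⟨g, fun x => DFunLike.congr_fun hg x, by exact_mod_cast hgf⟩

end Functions

end BanachGeometry

theorem mainTheorem1 (𝒞 : BanachGeometry.Ambient)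
    (X : Type u) [TopologicalSpace X] [CompactSpace X] [T2Space X]
    (R : Type v) [NormedField R] [CompleteSpace R] [BanachGeometry.Ultra 𝒞 R]
    (h : BanachGeometry.IsAdmissibleTriple 𝒞 X R) (K : TopologicalSpace.Closeds X) :
    BanachGeometry.BanAlg.IsHomotopyEpi (BanachGeometry.restriction 𝒞 R K) := by
  obtain ⟨hR, hX⟩ := h
  cases 𝒞 with
  | arch =>
    obtain ⟨h1, h2⟩ := BanachGeometry.hasSeparation_and_hasBddExtension_of_arch (X := X) hR
    exact BanachGeometry.isHomotopyEpi_restriction _ h1 h2 K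
  | nonarch =>
    have := hX rfl
    have : IsUltrametricDist R := BanachGeometry.Ultra.isUltrametricDist (𝒞 := .nonarch) rfl
    exact BanachGeometry.isHomotopyEpi_restriction _
      BanachGeometry.hasSeparation_of_totallyDisconnected
      BanachGeometry.hasBddExtension_of_totallyDisconnected K
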